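/- **Setting.** Let $F$ be a closed connected oriented smooth surface with base point $x$, and $I=[0,1]$. Identify $SU(2)$ with the unit quaternions; for a purely imaginary unit quaternion $Q$ put $e^{\alpha Q}=\cos\alpha+\sin\alpha\,Q$. Products in $\pi_1$ are read from left to right, and $\mathcal M(F)=\operatorname{Hom}(\pi_1(F,x),SU(2))/\mathrm{conj}$. Let $\phi:\mathbb R\to\mathbb R$ be a $C^k$, odd, $2\pi$-periodic function. Let $C\subset F$ be a smoothly embedded oriented circle missing $x$. Give $F\times I$ the product orientation, and let $N_C:S^1\times D^2\to F\times(0,1)$ be the product tubular neighborhood $N_C(s,z)=\big(c(s,-\operatorname{Im}z),\ \tfrac12+r\operatorname{Re}z\big)$ of $C\times\{\tfrac12\}$, where $0<r<\tfrac12$ and $c:S^1\times\mathbb R\to F$ is an orientation preserving smooth embedding with $c(\cdot,0)$ parametrizing $C$ and $x\notin c(S^1\times[-1,1])$. Thus $N_C$ preserves orientation, misses $\{x\}\times I$, and is framed so that $\lambda=N_C(S^1\times\{1\})$ is the push-off $C\times\{\tfrac12+r\}$. Put $\mu=N_C(\{1\}\times\partial D^2)$ and $\pi_C=(N_C,\phi)$.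 A $\pi_C$-perturbed representation is a homomorphism $\tilde\rho:\pi_1\big((F\times I)\setminus N_C(S^1\times\operatorname{int}D^2),(x,0)\big)\to SU(2)$ such that $\tilde\rho(\mu)=e^{\phi(\alpha)Q}$ when $\tilde\rho(\lambda)=e^{\alpha Q}$ (here $\mu,\lambda$ are connected to the base point by a common path). Let $\mathcal M_{\pi_C}(F\times I)$ be the set of conjugacy classes of these, and let $$\Phi_{\pi_C}:\ \mathcal M(F)=\mathcal M(F\times\{0\})\leftarrow\mathcal M_{\pi_C}(F\times I)\to\mathcal M(F\times\{1\})=\mathcal M(F)$$ be the composite of the inverse of restriction to $F\times\{0\}$ with restriction to $F\times\{1\}$. (Curves meet in a single point if they do so for exactly one parameter of $E$, respectively $\gamma_E$.) For a path $\gamma_E$ from $x$ to a point $p$ and a loop $E$ based at $p$, write $\rho(E)$ for $\rho([\gamma_E*E*\gamma_E^{-1}])$. If $C$ meets $E$ in a single point $y$ and misses $\gamma_E$, the longitude $\lambda_C(E)$ runs along $\gamma_E$, forward along $E$ to $y$, once around $C$, and the same way back. If $C$ misses $E$ and meets $\gamma_E$ in a single point $y$, it runs along $\gamma_E$ to $y$,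 once around $C$, and back along $\gamma_E$. **Proposition.** For every homomorphism $\rho:\pi_1(F,x)\to SU(2)$ there is a $\pi_C$-perturbed representation $\tilde\rho$ that restricts to $\rho$ on $F\times\{0\}$ and whose restriction $\rho'$ to $F\times\{1\}$ (connected to the base point along $\{x\}\times I$) represents $\Phi_{\pi_C}([\rho])$, such that, writing $\Phi_{\pi_C}(\rho)$ for $\rho'$, the following hold for all $E$ and $\gamma_E$. 1. If $C$ is disjoint from $E\cup\gamma_E$, then $\Phi_{\pi_C}(\rho)(E)=\rho(E)$. 2. If $C$ meets $E$ transversely in a single point with $E\cdot C=\varepsilon\in\{1,-1\}$ and misses $\gamma_E$, and if $\rho(\lambda_C(E))=e^{\alpha Q}$, then $\Phi_{\pi_C}(\rho)(E)=e^{\varepsilon\phi(\alpha)Q}\rho(E)$. 3. If $C$ misses $E$ and meets $\gamma_E$, oriented away from the base point, transversely in a single point with $\gamma_E\cdot C=\varepsilon\in\{1,-1\}$, and if $\rho(\lambda_C(E))=e^{\alpha Q}$, then $\Phi_{\pi_C}(\rho)(E)=e^{\varepsilon\phi(\alpha)Q}\rho(E)e^{-\varepsilon\phi(\alpha)Q}$.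 -/

import Mathlib

open scoped Manifold ContDiff Quaternion

noncomputable section

namespace CylinderPert

/-! ### Unit quaternions and perturbation functions -/

/-- `SU(2)`, identified with the group of unit quaternions. -/
abbrev SU2 : Type := unitary ℍ[ℝ]

/-- Purely imaginary quaternions of length one: unit vectors in the Lie algebra `su(2)`. -/
def IsUnitImag (Q : ℍ[ℝ]) : Prop := Q.re = 0 ∧ ‖Q‖ = 1

theorem exp_smul_unitImag {Q : ℍ[ℝ]} (hQ : IsUnitImag Q) (α : ℝ) :
    NormedSpace.exp (α • Q) = ((Real.cos α : ℝ) : ℍ[ℝ]) + Real.sin α • Q := by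
  rw [Quaternion.exp_of_re_eq_zero _ (by simp [hQ.1])]
  simp only [norm_smul, hQ.2, Real.norm_eq_abs, mul_one, Real.cos_abs]
  rcases eq_or_ne α 0 with rfl | h
  · simp
  · congr 1
    rw [smul_smul]
    congr 1
    rcases abs_cases α with ⟨h1, _⟩ | ⟨h1, _⟩ <;> rw [h1]
    · field_simp
    · rw [Real.sin_neg]; field_simp

theorem exp_mem_unitary {Q : ℍ[ℝ]} (hQ : Q.re = 0) :
    NormedSpace.exp Q ∈ unitary ℍ[ℝ] := by
  have h : ‖NormedSpace.exp Q‖ = 1 := by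
    rw [Quaternion.norm_exp, hQ]; simp
  have h2 : Quaternion.normSq (NormedSpace.exp Q) = 1 := by
    rw [Quaternion.normSq_eq_norm_mul_self, h]; norm_num
  rw [Unitary.mem_iff, Quaternion.star_mul_self, Quaternion.self_mul_star, h2]
  simp

/-- The perturbation functions: odd, `2π`-periodic functions `ℝ → ℝ` of class `C^k`. -/
structure PertFun (k : ℕ) where
  toFun : ℝ → ℝ
  contDiff : ContDiff ℝ k toFun
  odd : ∀ t, toFun (-t) = -toFun t
  periodic : ∀ t, toFun (t + 2 * Real.pi) = toFun t

instance (k : ℕ) : CoeFun (PertFun k) (fun _ => ℝ → ℝ) := ⟨PertFun.toFun⟩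

/-- The conjugation equivariant map `SU(2) → SU(2)`, `e^{αQ} ↦ e^{f(α)Q}`, written out for the
angle `α = arccos (Re g)` and the axis `Q = Im g / |Im g|`; see `pertMap_of_eq_exp`. -/
def pertMap {k : ℕ} (f : PertFun k) (g : SU2) : SU2 :=
  ⟨NormedSpace.exp (f (Real.arccos (g : ℍ[ℝ]).re) • (‖(g : ℍ[ℝ]).im‖⁻¹ • (g : ℍ[ℝ]).im)),
    exp_mem_unitary (by simp)⟩

/-- The defining property of `pertMap`, for every way of writing `g` as `e^{αQ}`. -/
theorem pertMap_of_eq_exp {k : ℕ} (f : PertFun k) (g : SU2) {α : ℝ} {Q : ℍ[ℝ]}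
    (hQ : IsUnitImag Q) (hg : (g : ℍ[ℝ]) = NormedSpace.exp (α • Q)) :
    (pertMap f g : ℍ[ℝ]) = NormedSpace.exp (f α • Q) := by
  have hper : ∀ (n : ℤ) t, f (t + n * (2 * Real.pi)) = f t := by
    intro n t
    have : Function.Periodic f.toFun (2 * Real.pi) := f.periodic
    exact this.int_mul n t
  rw [exp_smul_unitImag hQ] at hg
  have hQim : Q.im = Q := by ext <;> simp [hQ.1]
  have hre : (g : ℍ[ℝ]).re = Real.cos α := by rw [hg]; simp [hQ.1]
  have him : (g : ℍ[ℝ]).im = Real.sin α • Q := by rw [hg]; simp [hQim]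
  have hn : ‖(g : ℍ[ℝ]).im‖ = |Real.sin α| := by rw [him, norm_smul, hQ.2]; simp
  simp only [pertMap]
  congr 1
  rw [hn, hre, him, smul_smul, smul_smul]
  congr 1
  have hβ : 0 ≤ Real.sin (Real.arccos (Real.cos α)) :=
    Real.sin_nonneg_of_nonneg_of_le_pi (Real.arccos_nonneg _) (Real.arccos_le_pi _)
  have hc : Real.cos (Real.arccos (Real.cos α)) = Real.cos α :=
    Real.cos_arccos (Real.neg_one_le_cos α) (Real.cos_le_one α)
  generalize Real.arccos (Real.cos α) = β at hβ hc
  by_cases hs : Real.sin α = 0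
  · obtain ⟨n, hn⟩ := Real.sin_eq_zero_iff.1 hs
    have h1 : f α = f (-α) := by
      rw [← hper n (-α)]; congr 1; rw [← hn]; ring
    rw [f.odd] at h1
    rw [hs, show f α = 0 by linarith]; simp
  · obtain ⟨n, hn | hn⟩ := Real.cos_eq_cos_iff.1 hc
    · have hα : α = β + n * (2 * Real.pi) := by rw [hn]; ring
      have h2 : Real.sin α = Real.sin β := by rw [hα, Real.sin_add_int_mul_two_pi]
      rw [hα, hper, ← hα, h2, abs_of_nonneg hβ, mul_assoc, inv_mul_cancel₀ (h2 ▸ hs), mul_one]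
    · have hα : α = -β + n * (2 * Real.pi) := by rw [hn]; ring
      have h2 : Real.sin α = -Real.sin β := by rw [hα, Real.sin_add_int_mul_two_pi, Real.sin_neg]
      have h3 : Real.sin β ≠ 0 := by intro h; exact hs (by rw [h2, h, neg_zero])
      rw [hα, hper, ← hα, h2, abs_neg, abs_of_nonneg hβ, f.odd, mul_neg, mul_assoc,
        inv_mul_cancel₀ h3, mul_one]

/-! ### Fundamental groups, representations, character varieties -/

/-- The fundamental group with the usual product: `[p] * [q]` is first `p`, then `q`. (The product
of Mathlib's `FundamentalGroup` composes in the opposite order.) -/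
abbrev Pi1 (X : Type*) [TopologicalSpace X] (x : X) : Type _ := (FundamentalGroup X x)ᵐᵒᵖ

section
variable {X : Type*} [TopologicalSpace X] {x y : X}

/-- The element of the fundamental group represented by a based loop. -/
def loopClass (p : Path x x) : Pi1 X x :=
  MulOpposite.op (FundamentalGroup.fromPath (Path.Homotopic.Quotient.mk p))

theorem loopClass_trans (p q : Path x x) :
    loopClass (p.trans q) = loopClass p * loopClass q := rfl

/-- The based loop `δ * l * δ⁻¹`. -/
def connect (δ : Path x y) (l : Path y y) : Path x x := (δ.trans l).trans δ.symm

end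

/-- Homomorphisms from the fundamental group to `SU(2)`. -/
abbrev Rep (X : Type*) [TopologicalSpace X] (x : X) : Type _ := Pi1 X x →* SU2

/-- Conjugacy of homomorphisms to `SU(2)`. -/
def repSetoid (X : Type*) [TopologicalSpace X] (x : X) : Setoid (Rep X x) where
  r ρ σ := ∃ g : SU2, ∀ a, σ a = g * ρ a * g⁻¹
  iseqv :=
    { refl := fun ρ => ⟨1, by simp⟩
      symm := by
        rintro ρ σ ⟨g, hg⟩
        exact ⟨g⁻¹, fun a => by rw [hg]; group⟩
      trans := by
        rintro ρ σ τ ⟨g, hg⟩ ⟨h, hh⟩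
        exact ⟨h * g, fun a => by rw [hh, hg]; group⟩ }

/-- The `SU(2)` character variety (as a set): conjugacy classes of homomorphisms
`π₁(X, x) → SU(2)`. -/
def CharVar (X : Type*) [TopologicalSpace X] (x : X) : Type _ := Quotient (repSetoid X x)

/-- The conjugacy class of a homomorphism. -/
def CharVar.mk {X : Type*} [TopologicalSpace X] {x : X} (ρ : Rep X x) : CharVar X x :=
  Quotient.mk (repSetoid X x) ρ

/-- The homomorphism `π₁(Y, y) → π₁(X, x)` given by a continuous map `f : Y → X` and a path `δ`
from `x` to `f y`; it sends `[l]` to `[δ * f(l) * δ⁻¹]`. -/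
def pi1Map {X Y : Type*} [TopologicalSpace X] [TopologicalSpace Y] {x : X} (f : C(Y, X)) (y : Y)
    (δ : Path x (f y)) : Pi1 Y y →* Pi1 X x :=
  MonoidHom.op
    ((FundamentalGroup.fundamentalGroupMulEquivOfPath δ.symm).toMonoidHom.comp
      (FundamentalGroup.map f y))

theorem pi1Map_loopClass {X Y : Type*} [TopologicalSpace X] [TopologicalSpace Y] {x : X}
    (f : C(Y, X)) (y : Y) (δ : Path x (f y)) (l : Path y y) :
    pi1Map f y δ (loopClass l) = loopClass (connect δ (l.map f.continuous)) := by
  apply MulOpposite.unop_injective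
  change (FundamentalGroup.fundamentalGroupMulEquivOfPath δ.symm)
    (FundamentalGroup.fromPath (Path.Homotopic.Quotient.mk (l.map f.continuous))) =
      FundamentalGroup.fromPath (Path.Homotopic.Quotient.mk (connect δ (l.map f.continuous)))
  simp only [FundamentalGroup.fundamentalGroupMulEquivOfPath, CategoryTheory.Iso.conj_apply]
  rw [← CategoryTheory.Category.assoc]
  change Path.Homotopic.Quotient.mk ((δ.symm.symm.trans _).trans δ.symm) = _
  rw [Path.symm_symm]
  rfl

/-! ### Oriented surfaces and curves on them -/

/-- The standard area form of the plane. -/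
def cross (v w : EuclideanSpace ℝ (Fin 2)) : ℝ := v 0 * w 1 - v 1 * w 0

section
variable {F : Type*} [TopologicalSpace F] [ChartedSpace (EuclideanSpace ℝ (Fin 2)) F]

variable (F) in
/-- All coordinate changes between the charts of the atlas preserve the orientation. The surface is
then oriented by declaring all its charts orientation preserving. -/
def IsOrientedAtlas : Prop :=
  ∀ e ∈ atlas (EuclideanSpace ℝ (Fin 2)) F, ∀ e' ∈ atlas (EuclideanSpace ℝ (Fin 2)) F,
    ∀ v ∈ (e.symm.trans e').source, 0 < (fderiv ℝ (e.symm.trans e') v).det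

/-- The sign of the pair of velocity vectors `(u'(t), v'(s))` of two curves through the same point
`q = u(t) = v(s)`, in an oriented chart at `q`: it is `1` for a positive basis of the tangent plane,
`-1` for a negative basis, and `0` if the vectors are linearly dependent. -/
def crossSign (u v : ℝ → F) (t s : ℝ) : SignType :=
  SignType.sign
    (cross (deriv (fun τ => chartAt (EuclideanSpace ℝ (Fin 2)) (u t) (u τ)) t)
      (deriv (fun σ => chartAt (EuclideanSpace ℝ (Fin 2)) (u t) (v σ)) s))

variable (F) in
/-- A smoothly embedded oriented circle in the surface, as a `1`-periodic parametrization. -/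
structure EmbeddedCircle where
  toFun : ℝ → F
  smooth : ContMDiff 𝓘(ℝ, ℝ) (𝓡 2) ∞ toFun
  periodic : ∀ s, toFun (s + 1) = toFun s
  injective : ∀ s t, toFun s = toFun t → ∃ n : ℤ, t = s + n
  immersion : ∀ s, mfderiv 𝓘(ℝ, ℝ) (𝓡 2) toFun s ≠ 0

instance : CoeFun (EmbeddedCircle F) (fun _ => ℝ → F) := ⟨EmbeddedCircle.toFun⟩

/-- The point set of an embedded circle. -/
def EmbeddedCircle.carrier (C : EmbeddedCircle F) : Set F := Set.range C

/-- The loop that runs once around `C`, starting and ending at `C s`. -/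
def EmbeddedCircle.loop (C : EmbeddedCircle F) (s : ℝ) : Path (C s) (C s) where
  toFun t := C (s + t)
  continuous_toFun := C.smooth.continuous.comp (by fun_prop)
  source' := by simp
  target' := by simpa using C.periodic s

/-- `p` meets `C` transversely in exactly one point, for the parameter `t` of `p` and the parameter
`s` of `C`, with oriented intersection number `p · C = ε`. -/
structure MeetsOnce {a b : F} (p : Path a b) (C : EmbeddedCircle F) (t : unitInterval) (s : ℝ)
    (ε : ℤˣ) : Prop where
  meets : p t = C s
  unique : ∀ t' : unitInterval, p t' ∈ C.carrier → t' = t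
  sign : crossSign p.extend C t s = SignType.sign (ε : ℤ)

/-- The longitude of `C` with respect to a loop `E` connected to the base point by `γ`, for an
intersection point `E t = C s`: along `γ`, forward along `E` to the intersection point, once around
`C`, and the same way back. -/
def longitudeLoop {x p : F} (C : EmbeddedCircle F) (γ : Path x p) (E : Path p p) {t : unitInterval} {s : ℝ}
    (h : E t = C s) : Path x x :=
  connect (γ.trans ((E.subpath 0 t).cast E.source.symm h.symm)) (C.loop s)

/-- The longitude of `C` with respect to a loop which is connected to the base point by `γ`, for an
intersection point `γ t = C s`: along `γ` to the intersection point, once around `C`, and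
back along `γ`. -/
def longitudeArc {x p : F} (C : EmbeddedCircle F) (γ : Path x p) {t : unitInterval} {s : ℝ}
    (h : γ t = C s) : Path x x :=
  connect ((γ.subpath 0 t).cast γ.source.symm h.symm) (C.loop s)

/-! ### The perturbation solid torus in the cylinder -/

/-- A tubular neighborhood of `C × {1/2}` in the cylinder `F × [0, 1]` that misses the segment over
the base point `x`. It is the product of the annulus `|u| ≤ 1` in a tubular neighborhood
`collar : S¹ × ℝ → F` of `C` (an orientation preserving smooth embedding, `1`-periodic in the first
variable) with an interval of half-length `height`; see `PertTube.map` for its framing. -/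
structure PertTube (C : EmbeddedCircle F) (x : F) where
  collar : ℝ × ℝ → F
  smooth : ContMDiff 𝓘(ℝ, ℝ × ℝ) (𝓡 2) ∞ collar
  periodic : ∀ s u, collar (s + 1, u) = collar (s, u)
  injective : ∀ s u s' u', collar (s, u) = collar (s', u') → u' = u ∧ ∃ n : ℤ, s' = s + n
  oriented : ∀ s u, crossSign (fun s' => collar (s', u)) (fun u' => collar (s, u')) s u = 1
  core : ∀ s, collar (s, 0) = C s
  height : ℝ
  height_pos : 0 < height
  height_lt : height < 1 / 2
  base_notMem : ∀ s u, |u| ≤ 1 → collar (s, u) ≠ x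

namespace PertTube
variable {C : EmbeddedCircle F} {x : F} (N : PertTube C x)

/-- The embedding `N : S¹ × D² → F × (0, 1)`, with `D²` the closed unit disk in `ℂ` and `S¹ = ℝ / ℤ`.
The disk direction `1` points upwards, so that `N (S¹ × {1})` is a push-off `C × {1/2 + ε}`; the disk
direction `i` points to the right of `C`, so that `N` preserves the product orientations. -/
def map (s : ℝ) (z : ℂ) : F × ℝ := (N.collar (s, -z.im), 1 / 2 + N.height * z.re)

theorem continuous_map : Continuous fun p : ℝ × ℂ => N.map p.1 p.2 := by
  have := N.smooth.continuous
  unfold map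
  fun_prop

theorem map_injective {s s' : ℝ} {z z' : ℂ} (h : N.map s z = N.map s' z') : z' = z := by
  have h1 := congrArg Prod.fst h
  have h2 := congrArg Prod.snd h
  simp only [map] at h1 h2
  have h3 := (N.injective _ _ _ _ h1).1
  have := N.height_pos
  apply Complex.ext
  · have : N.height * (z'.re - z.re) = 0 := by linarith
    rcases mul_eq_zero.1 this with h | h <;> linarith
  · linarith

theorem map_snd_mem {s : ℝ} {z : ℂ} (hz : ‖z‖ < 1) :
    0 < (N.map s z).2 ∧ (N.map s z).2 < 1 := by
  have h := abs_lt.1 ((Complex.abs_re_le_norm z).trans_lt hz)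
  have h1 := N.height_pos
  have h2 := N.height_lt
  simp only [map]
  constructor <;> nlinarith [h.1, h.2]

/-- The cylinder `F × [0, 1]` with the open solid torus `N (S¹ × int D²)` removed. -/
def exterior : Set (F × ℝ) :=
  {q | q.2 ∈ Set.Icc (0 : ℝ) 1 ∧ ∀ (s : ℝ) (z : ℂ), ‖z‖ < 1 → N.map s z ≠ q}

theorem map_mem_exterior (s : ℝ) {z : ℂ} (hz : ‖z‖ = 1) : N.map s z ∈ N.exterior := by
  have h := abs_le.1 ((Complex.abs_re_le_norm z).trans_eq hz)
  have h1 := N.height_pos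
  have h2 := N.height_lt
  refine ⟨?_, fun s' z' hz' he => ?_⟩
  · simp only [map]
    constructor <;> nlinarith [h.1, h.2]
  · rw [← N.map_injective he, hz] at hz'
    exact lt_irrefl _ hz'

/-- The inclusion of the end `F = F × {0}`. -/
def inclBottom : C(F, N.exterior) where
  toFun y := ⟨(y, 0), by simp, fun s z hz he => by
    have := (N.map_snd_mem (s := s) hz).1
    rw [he] at this
    exact lt_irrefl _ this⟩
  continuous_toFun := by fun_prop

/-- The inclusion of the end `F = F × {1}`. -/
def inclTop : C(F, N.exterior) where
  toFun y := ⟨(y, 1), by simp, fun s z hz he => by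
    have := (N.map_snd_mem (s := s) hz).2
    rw [he] at this
    exact lt_irrefl _ this⟩
  continuous_toFun := by fun_prop

/-- The path `{x} × [0, 1]` over the base point. -/
def vertical : Path (N.inclBottom x) (N.inclTop x) where
  toFun t := ⟨(x, t), t.2, fun s z hz he => N.base_notMem s (-z.im)
    (by rw [abs_neg]; exact (Complex.abs_im_le_norm z).trans hz.le) (congrArg Prod.fst he)⟩
  continuous_toFun := by fun_prop
  source' := by ext <;> rfl
  target' := by ext <;> rfl

/-- The point `N (1, 1)` of the boundary torus. -/
def corner : N.exterior := ⟨N.map 0 1, N.map_mem_exterior 0 (by simp)⟩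

/-- The meridian `μ = N ({1} × ∂D²)`. -/
def meridian : Path N.corner N.corner where
  toFun t := ⟨N.map 0 (Complex.exp ((2 * Real.pi * (t : ℝ) : ℝ) * Complex.I)),
    N.map_mem_exterior 0 (Complex.norm_exp_ofReal_mul_I _)⟩
  continuous_toFun :=
    (N.continuous_map.comp (by fun_prop : Continuous fun t : unitInterval =>
      ((0 : ℝ), Complex.exp ((2 * Real.pi * (t : ℝ) : ℝ) * Complex.I)))).subtype_mk _
  source' := by simp [corner]
  target' := by simp [corner]

/-- The longitude `λ = N (S¹ × {1})`. -/
def longitude : Path N.corner N.corner where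
  toFun t := ⟨N.map t 1, N.map_mem_exterior t (by simp)⟩
  continuous_toFun :=
    (N.continuous_map.comp (by fun_prop : Continuous fun t : unitInterval =>
      ((t : ℝ), (1 : ℂ)))).subtype_mk _
  source' := by simp [corner]
  target' := by
    have := N.periodic 0 0
    rw [zero_add] at this
    simp [corner, map, this]

/-! ### Perturbed representations -/

/-- The perturbation condition `ρ(μ) = f(ρ(λ))`, where `f(e^{αQ}) = e^{φ(α)Q}`. Here `μ` and `λ` are
connected to the base point by a common path `δ`; the condition does not depend on `δ`. -/
def IsPerturbed {k : ℕ} (φ : PertFun k) (ρ : Rep N.exterior (N.inclBottom x)) : Prop :=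
  ∀ δ : Path (N.inclBottom x) N.corner,
    ρ (loopClass (connect δ N.meridian)) =
      pertMap φ (ρ (loopClass (connect δ N.longitude)))

/-- The perturbed representations of the cylinder, for the perturbation data `(N, φ)`. -/
def PertRep {k : ℕ} (φ : PertFun k) : Type _ :=
  {ρ : Rep N.exterior (N.inclBottom x) // N.IsPerturbed φ ρ}

variable {N} {k : ℕ} {φ : PertFun k}

/-- The restriction to `F × {0}`. -/
def PertRep.bottom (ρ : N.PertRep φ) : Rep F x :=
  ρ.1.comp (pi1Map N.inclBottom x (Path.refl _))

/-- The restriction to `F × {1}`, connected to the base point along `{x} × [0, 1]`. -/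
def PertRep.top (ρ : N.PertRep φ) : Rep F x :=
  ρ.1.comp (pi1Map N.inclTop x N.vertical)

variable (N φ)

/-- The perturbed character variety of the cylinder (as a set). -/
def PertCharVar : Type _ :=
  Quotient ((repSetoid N.exterior (N.inclBottom x)).comap
    (Subtype.val : N.PertRep φ → Rep N.exterior (N.inclBottom x)))

/-- The restriction map from the perturbed character variety to that of `F × {0}`. -/
def restrictBottom : N.PertCharVar φ → CharVar F x :=
  Quotient.lift (fun ρ => CharVar.mk (PertRep.bottom ρ))
    (fun _ _ ⟨g, hg⟩ => Quotient.sound ⟨g, fun _ => hg _⟩)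

/-- The restriction map from the perturbed character variety to that of `F × {1}`. -/
def restrictTop : N.PertCharVar φ → CharVar F x :=
  Quotient.lift (fun ρ => CharVar.mk (PertRep.top ρ))
    (fun _ _ ⟨g, hg⟩ => Quotient.sound ⟨g, fun _ => hg _⟩)

/-- The map `𝓜(F) = 𝓜(F × {0}) ← 𝓜_π(F × I) → 𝓜(F × {1}) = 𝓜(F)`: a class is extended to a perturbed
class of the cylinder, which is then restricted to the other end. (Both restriction maps are
bijective; where a class had no extension the formula below would return the class itself.) -/
def Phi : CharVar F x → CharVar F x :=
  Function.extend (N.restrictBottom φ) (N.restrictTop φ) id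

end PertTube

end

end CylinderPert

end

/-!
A representation is extended to a parallel transport along all paths (a flat connection). Given such
a transport `R` on `F` and a conjugation equivariant map `f`, pull `R` back to the exterior of the
solid torus and cut the exterior along the vertical annulus that joins the solid torus to the top.
Regluing with the jump `f (h)`, where `h` is the holonomy around `C`, gives a flat connection, since
`f (h)` commutes with `h`. The meridian crosses the cut once, whence the perturbation condition, and
so does the part of a loop on the top that crosses `C`, whence the three formulas.

For the map `Phi` to take the value asserted, the restriction to the top has to be determined by the
restriction to the bottom. Given an arbitrary perturbed transport `S`, move from the bottom to the
top along vertical paths off the solid torus, passing it on the left or on the right of the core.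
The two ways differ by the meridian, that is, by `f (h)`, so in the resulting frame the top of `S`
is the top of the twisted transport.
-/

noncomputable section

namespace CylinderPert

open unitInterval Filter Topology

/-! ### Functions glued from locally defined ones -/

section PathsInCovers

variable {Y α G ι : Type*} [TopologicalSpace Y] {U : ι → Set Y}

theorem eq_of_joinedIn_of_continuousOn [TopologicalSpace α] [DiscreteTopology α] {V : Set Y}
    {f : Y → α} (hf : ContinuousOn f V) {P Q : Y} (hPQ : JoinedIn V P Q) : f P = f Q := by
  obtain ⟨w, hw⟩ := hPQ
  simpa using PreconnectedSpace.constant (inferInstance : PreconnectedSpace I)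
    (hf.comp_continuous w.continuous hw) (x := 0) (y := 1)

variable [LocallyPathConnectedSpace Y]

theorem continuousOn_of_forall_joinedIn_eq [TopologicalSpace α] {V : Set Y} (hV : IsOpen V)
    {f : Y → α} (hf : ∀ P Q, JoinedIn V P Q → f P = f Q) : ContinuousOn f V := fun P hP =>
  (tendsto_nhds_of_eventually_eq (Filter.mem_of_superset
    ((hV.pathComponentIn P).mem_nhds (mem_pathComponentIn_self hP))
    fun Q hQ => (hf P Q hQ).symm)).mono_left nhdsWithin_le_nhds

theorem eq_of_forall_joinedIn_eq [PreconnectedSpace Y] (hU : ∀ i, IsOpen (U i))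
    (hcov : ∀ y, ∃ i, y ∈ U i) {f : Y → α} (hf : ∀ i P Q, JoinedIn (U i) P Q → f P = f Q)
    (P Q : Y) : f P = f Q := by
  let _ : TopologicalSpace α := ⊥
  have : DiscreteTopology α := ⟨rfl⟩
  refine PreconnectedSpace.constant ‹_› (continuous_iff_continuousAt.2 fun y => ?_)
  obtain ⟨i, hi⟩ := hcov y
  exact (continuousOn_of_forall_joinedIn_eq (hU i) (hf i)).continuousAt ((hU i).mem_nhds hi)

/-- The functions `h j * (h i)⁻¹` are the transition functions of a covering space of `Y`, and a
section of this covering space amounts to a function `θ` as claimed. -/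
theorem exists_forall_joinedIn_mul_inv_eq [SimplyConnectedSpace Y] [Group G]
    (hU : ∀ i, IsOpen (U i)) (hcov : ∀ y, ∃ i, y ∈ U i) (h : ι → Y → G)
    (hh : ∀ i j P Q, JoinedIn (U i ∩ U j) P Q → h j P * (h i P)⁻¹ = h j Q * (h i Q)⁻¹) :
    ∃ θ : Y → G, ∀ i P Q, JoinedIn (U i) P Q → h i P * (θ P)⁻¹ = h i Q * (θ Q)⁻¹ := by
  let _ : TopologicalSpace G := ⊥
  have : DiscreteTopology G := ⟨rfl⟩
  choose ind hind using hcov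
  let Z : FiberBundleCore ι Y G :=
    { baseSet := U
      isOpen_baseSet := hU
      indexAt := ind
      mem_baseSet_at := hind
      coordChange i j y v := h j y * (h i y)⁻¹ * v
      coordChange_self i y _ v := by simp
      continuousOn_coordChange i j := by
        have hc := continuousOn_of_forall_joinedIn_eq ((hU i).inter (hU j)) (hh i j)
        exact (continuous_of_discreteTopology (f := fun q : G × G => q.1 * q.2)).comp_continuousOn
          ((hc.comp continuousOn_fst fun _ hp => hp.1).prodMk continuousOn_snd)
      coordChange_comp i j k y _ v := by group }
  obtain ⟨y₀⟩ : Nonempty Y := inferInstance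
  obtain ⟨e, ⟨-, he⟩, -⟩ := (FiberBundle.isCoveringMap (F := G)
    (E := Z.Fiber)).existsUnique_continuousMap_lifts (.id Y) y₀ ⟨y₀, (1 : G)⟩ rfl
  have he_fst (y : Y) : (e y).1 = y := congrFun he y
  let v (y : Y) : G := (e y).2
  let θ (y : Y) : G := (v y)⁻¹ * h (ind y) y
  refine ⟨θ, fun i P Q hPQ =>
    eq_of_joinedIn_of_continuousOn (f := fun y => h i y * (θ y)⁻¹) ?_ hPQ⟩
  have hc : ContinuousOn (fun y => (Z.localTriv i (e y)).2) (U i) :=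
    continuous_snd.comp_continuousOn
      ((Z.localTriv i).continuousOn_toFun.comp e.continuous.continuousOn fun y hy => by
        rw [FiberBundleCore.mem_localTriv_source, he_fst y]; exact hy)
  refine hc.congr fun y _ => ?_
  change h i y * (θ y)⁻¹ = h i (e y).1 * (h (ind (e y).1) (e y).1)⁻¹ * v y
  simp only [he_fst, θ, mul_inv_rev, inv_inv, mul_assoc]

end PathsInCovers

/-! ### Parallel transport and gauge transformations -/

/-- A homotopy invariant parallel transport along the paths of `X` with values in `G`, that is, a
functor from the fundamental groupoid of `X` to `G`: the holonomy of a flat connection on a trivial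
bundle. -/
@[ext]
structure Transport (X G : Type*) [TopologicalSpace X] [Group G] where
  hol : ∀ {a b : X}, Path a b → G
  hol_trans : ∀ {a b c : X} (p : Path a b) (q : Path b c), hol (p.trans q) = hol p * hol q
  hol_congr : ∀ {a b : X} {p q : Path a b}, p.Homotopic q → hol p = hol q

instance contractibleSpace_unitInterval : ContractibleSpace I :=
  (convex_Icc (0 : ℝ) 1).contractibleSpace ⟨0, by simp⟩

/-- The affine path from `s` to `t` in the unit interval. -/
def segPath (s t : I) : Path s t :=
  (⟨⟨id, continuous_id⟩, rfl, rfl⟩ : Path (0 : I) 1).subpath s t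

theorem coe_segPath (s t r : I) : (segPath s t r : ℝ) = (1 - r) * s + r * t := by
  simp [segPath, Path.subpath]

theorem segPath_mem_uIcc (s t r : I) : segPath s t r ∈ Set.uIcc s t := by
  have h := Set.mem_range_self (f := segPath s t) r
  rwa [segPath, Path.range_subpath, Path.coe_mk', ContinuousMap.coe_mk, Set.image_id] at h

theorem segPath_mem_Icc {s t : I} (h : s ≤ t) (r : I) : segPath s t r ∈ Set.Icc s t :=
  Set.uIcc_of_le h ▸ segPath_mem_uIcc s t r

theorem segPath_zero_one (t : I) : segPath 0 1 t = t := by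
  simp [segPath, Path.subpath]

theorem trans_apply_segPath_zero {X : Type*} [TopologicalSpace X] {a b c : X} (p : Path a b)
    (q : Path b c) {r : I} (hr : (r : ℝ) = 1 / 2) (t : I) : p.trans q (segPath 0 r t) = p t := by
  have coe_seg : (segPath 0 r t : ℝ) = t / 2 := by
    rw [coe_segPath, hr, Set.Icc.coe_zero]
    ring
  rw [Path.trans_apply, dif_pos (by rw [coe_seg]; linarith [t.2.2])]
  congr 1
  ext
  simp only [coe_seg]
  ring

theorem trans_apply_segPath_one {X : Type*} [TopologicalSpace X] {a b c : X} (p : Path a b)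
    (q : Path b c) {r : I} (hr : (r : ℝ) = 1 / 2) (t : I) : p.trans q (segPath r 1 t) = q t := by
  have symm_trans := trans_apply_segPath_zero q.symm p.symm (r := σ r)
    (by rw [coe_symm_eq, hr]; norm_num) (σ t)
  rw [← Path.trans_symm, Path.symm_apply, Path.symm_apply, Function.comp_apply,
    Function.comp_apply, symm_symm] at symm_trans
  rw [← symm_trans]
  congr 1
  ext
  simp only [coe_segPath, coe_symm_eq, Set.Icc.coe_zero, Set.Icc.coe_one]
  ring

section FundamentalGroup

variable {X : Type*} [TopologicalSpace X] {x : X}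

theorem loopClass_surjective : Function.Surjective (loopClass (x := x)) := fun a =>
  let ⟨p, hp⟩ := Path.Homotopic.Quotient.mk_surjective (x₀ := x) (x₁ := x) a.unop
  ⟨p, congrArg MulOpposite.op hp⟩

theorem loopClass_congr {p q : Path x x} (h : p.Homotopic q) : loopClass p = loopClass q :=
  congrArg MulOpposite.op (Path.Homotopic.Quotient.eq.2 h)

theorem loopClass_symm (p : Path x x) : loopClass p.symm = (loopClass p)⁻¹ :=
  (inv_eq_of_mul_eq_one_right
    (loopClass_congr ⟨(Path.Homotopy.reflTransSymm p).symm⟩)).symm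

theorem loopClass_trans_trans_symm {a b d : X} (u : Path x a) (p : Path a b) (v : Path x b)
    (q : Path b d) (w : Path x d) :
    loopClass ((u.trans (p.trans q)).trans w.symm) =
      loopClass ((u.trans p).trans v.symm) * loopClass ((v.trans q).trans w.symm) := by
  rw [← loopClass_trans]
  apply loopClass_congr
  rw [← Path.Homotopic.Quotient.eq]
  simp only [Path.Homotopic.Quotient.mk_trans, Path.Homotopic.Quotient.mk_symm,
    Path.Homotopic.Quotient.trans_assoc]
  congr 2
  rw [← Path.Homotopic.Quotient.trans_assoc (Path.Homotopic.Quotient.symm _)]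
  simp

end FundamentalGroup

namespace Transport

variable {X Y Z G : Type*} [TopologicalSpace X] [TopologicalSpace Y] [TopologicalSpace Z] [Group G]
  (R : Transport X G)

theorem hol_refl (a : X) : R.hol (Path.refl a) = 1 := by
  simpa using R.hol_trans (Path.refl a) (Path.refl a)

theorem hol_symm {a b : X} (p : Path a b) : R.hol p.symm = (R.hol p)⁻¹ := by
  rw [eq_comm, inv_eq_iff_mul_eq_one, ← R.hol_trans, ← R.hol_refl a]
  exact R.hol_congr ⟨(Path.Homotopy.reflTransSymm p).symm⟩

theorem hol_ext {a b a' b' : X} {p : Path a b} {q : Path a' b'} (h : ∀ t, p t = q t) :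
    R.hol p = R.hol q := by
  obtain rfl : a = a' := by simpa using h 0
  obtain rfl : b = b' := by simpa using h 1
  congr 1
  ext t
  exact h t

theorem hol_cast {a b a' b' : X} (p : Path a b) (ha : a' = a) (hb : b' = b) :
    R.hol (p.cast ha hb) = R.hol p :=
  R.hol_ext fun _ => rfl

theorem hol_connect {a b : X} (p : Path a b) (q : Path b b) :
    R.hol (connect p q) = R.hol p * R.hol q * (R.hol p)⁻¹ := by
  rw [connect, R.hol_trans, R.hol_trans, R.hol_symm]

/-- The transport along the image in `X` of any path from `P` to `Q` in the simply connected space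
`Y`. -/
def along [SimplyConnectedSpace Y] (f : C(Y, X)) (P Q : Y) : G :=
  R.hol ((PathConnectedSpace.somePath P Q).map f.continuous)

section Along

variable [SimplyConnectedSpace Y] [SimplyConnectedSpace Z] (f : C(Y, X))

theorem hol_eq_along {a b : X} {p : Path a b} {P Q : Y} (w : Path P Q) (h : ∀ t, p t = f (w t)) :
    R.hol p = R.along f P Q := by
  rw [along, R.hol_congr ((SimplyConnectedSpace.paths_homotopic _ w).map f)]
  exact R.hol_ext h

theorem along_mul (P Q S : Y) : R.along f P Q * R.along f Q S = R.along f P S := by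
  rw [along, along, ← R.hol_trans, ← Path.map_trans]
  exact R.hol_eq_along f _ fun t => rfl

theorem along_self (P : Y) : R.along f P P = 1 := by
  simpa using R.along_mul f P P P

theorem along_inv (P Q : Y) : (R.along f P Q)⁻¹ = R.along f Q P := by
  rw [inv_eq_iff_mul_eq_one, R.along_mul, R.along_self]

theorem along_comp (k : C(Z, Y)) (P Q : Z) :
    R.along (f.comp k) P Q = R.along f (k P) (k Q) :=
  R.hol_eq_along f ((PathConnectedSpace.somePath P Q).map k.continuous) fun _ => rfl

theorem along_eq_of_forall_eq {f g : C(Y, X)} {P Q : Y} (w : Path P Q)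
    (h : ∀ t, f (w t) = g (w t)) : R.along f P Q = R.along g P Q :=
  (R.hol_eq_along f (p := w.map f.continuous) w fun _ => rfl).symm.trans (R.hol_eq_along g w h)

theorem along_map_of_comp_eq (k : C(Y, Y)) (h : f.comp k = f) (P Q : Y) :
    R.along f (k P) (k Q) = R.along f P Q := by
  rw [← R.along_comp, h]

end Along

theorem hol_eq_along_self {a b : X} (p : Path a b) : R.hol p = R.along (p : C(I, X)) 0 1 :=
  R.hol_eq_along (p : C(I, X)) (segPath 0 1) fun t => by simp [segPath_zero_one]

theorem hol_subpath {a b : X} (p : Path a b) (s t : I) :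
    R.hol (p.subpath s t) = R.along (p : C(I, X)) s t :=
  R.hol_eq_along (p : C(I, X)) (segPath s t) fun _ => rfl

theorem hol_eq_subpath_mul_subpath {a b : X} (p : Path a b) (t : I) :
    R.hol p = R.hol (p.subpath 0 t) * R.hol (p.subpath t 1) := by
  rw [hol_subpath, hol_subpath, along_mul, hol_eq_along_self]

theorem hol_subpath_mul_subpath {a b : X} (p : Path a b) (r s t : I) :
    R.hol (p.subpath r s) * R.hol (p.subpath s t) = R.hol (p.subpath r t) := by
  rw [hol_subpath, hol_subpath, hol_subpath, along_mul]

theorem hol_subpath_eq_along [SimplyConnectedSpace Y] (f : C(Y, X)) {a b : X} (p : Path a b)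
    {s t : I} (hst : s ≤ t) (L : C(I, Y)) (h : ∀ r ∈ Set.Icc s t, p r = f (L r)) :
    R.hol (p.subpath s t) = R.along f (L s) (L t) :=
  R.hol_eq_along f ((segPath s t).map L.continuous) fun r => h _ (segPath_mem_Icc hst r)

/-- The pull-back of a transport. -/
def comap (f : C(Y, X)) : Transport Y G where
  hol p := R.hol (p.map f.continuous)
  hol_trans p q := by rw [Path.map_trans, R.hol_trans]
  hol_congr h := R.hol_congr (h.map f)

/-- The gauge transform of a transport by a change of frame `k`. -/
def gauge (k : X → G) : Transport X G where
  hol {a b} p := (k a)⁻¹ * R.hol p * k b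
  hol_trans p q := by rw [R.hol_trans]; group
  hol_congr h := by rw [R.hol_congr h]

theorem hol_gauge (k : X → G) {a b : X} (p : Path a b) :
    (R.gauge k).hol p = (k a)⁻¹ * R.hol p * k b := rfl

/-- The representation of the fundamental group given by the transport along loops. -/
def toHom (x : X) : Pi1 X x →* G where
  toFun a := Quotient.lift (s := Path.Homotopic.setoid x x) (fun p => R.hol p)
    (fun _ _ h => R.hol_congr h) a.unop
  map_one' := R.hol_refl x
  map_mul' a b := by
    obtain ⟨p, rfl⟩ := loopClass_surjective a
    obtain ⟨q, rfl⟩ := loopClass_surjective b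
    exact R.hol_trans p q

theorem toHom_loopClass {x : X} (p : Path x x) : R.toHom x (loopClass p) = R.hol p := rfl

open Classical in
/-- A representation is extended to paths by closing them up with chosen paths to the base point;
the gauge transformation corrects for the chosen path from the base point to itself. -/
theorem exists_hol_eq {x : X} (ρ : Pi1 X x →* G) :
    ∃ R : Transport X G, ∀ p : Path x x, R.hol p = ρ (loopClass p) := by
  let δ (a : X) (h : Joined x a) : Path x a := h.some
  have joined_of_path {a b : X} (p : Path a b) (h : Joined x a) : Joined x b := h.trans ⟨p⟩
  let S : Transport X G :=
    { hol := fun {a b} p => if h : Joined x a then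
        ρ (loopClass (((δ a h).trans p).trans (δ b (joined_of_path p h)).symm)) else 1
      hol_trans := fun {a b d} p q => by
        by_cases h : Joined x a
        · have hb : Joined x b := joined_of_path p h
          simp only [dif_pos h, dif_pos hb, ← map_mul, ← loopClass_trans_trans_symm]
        · have hb : ¬ Joined x b := fun hb => h (joined_of_path p.symm hb)
          simp only [dif_neg h, dif_neg hb, one_mul]
      hol_congr := fun {a b p q} hpq => by
        split_ifs
        · exact congrArg ρ <| loopClass_congr <|
            ((Path.Homotopic.refl _).hcomp hpq).hcomp (Path.Homotopic.refl _)
        · rfl }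
  have hx : Joined x x := Joined.refl x
  refine ⟨S.gauge fun _ => ρ (loopClass (δ x hx)), fun p => ?_⟩
  simp only [hol_gauge, S, dif_pos hx, loopClass_trans, loopClass_symm, map_mul, map_inv]
  group

theorem exists_hol_eq_gauge [PathConnectedSpace X] {x : X} {R S : Transport X G} (g : G)
    (h : ∀ p : Path x x, S.hol p = g * R.hol p * g⁻¹) :
    ∃ k : X → G, S = R.gauge k := by
  let δ (a : X) : Path x a := PathConnectedSpace.somePath x a
  refine ⟨fun a => (R.hol (δ a))⁻¹ * g⁻¹ * S.hol (δ a), Transport.ext ?_⟩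
  funext a b p
  have hp := h (((δ a).trans p).trans (δ b).symm)
  simp only [hol_trans, hol_symm] at hp
  have : S.hol p = (S.hol (δ a))⁻¹ * (S.hol (δ a) * S.hol p * (S.hol (δ b))⁻¹) * S.hol (δ b) := by
    group
  rw [this, hp, hol_gauge]
  group

end Transport

/-! ### Gluing transports -/

instance locallyPathConnectedSpace_unitInterval : LocallyPathConnectedSpace I :=
  (Topology.IsQuotientMap.of_inverse continuous_subtype_val continuous_projIcc
    (Set.projIcc_val zero_le_one)).locallyPathConnectedSpace

theorem mul_inv_eq_mul_inv_iff_inv_mul_eq {G : Type*} [Group G] {a b c d : G} :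
    a * b⁻¹ = c * d⁻¹ ↔ a⁻¹ * c = b⁻¹ * d := by
  rw [inv_mul_eq_iff_eq_mul, ← mul_assoc, eq_comm, mul_inv_eq_iff_eq_mul]

namespace Transport

variable {X Y Z G ι : Type*} [TopologicalSpace X] [TopologicalSpace Y] [TopologicalSpace Z]
  [Group G] {R : Transport X G} {U : ι → Set X} {g : ι → X → G}

variable (R U g) in
/-- `θ` is a horizontal section over `f` of the flat bundle that is glued from trivial bundles over
the sets `U i`, with the transport `R` gauge transformed by `g i`. As transport acts on frames, the
holonomy between two points appears as `(θ P)⁻¹ * θ Q`. -/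
def IsHorizontal (f : C(Y, X)) (θ : Y → G) : Prop :=
  ∀ i {P Q : Y} (w : Path P Q), (∀ t, f (w t) ∈ U i) →
    (θ P)⁻¹ * θ Q = g i (f P) * R.hol (w.map f.continuous) * (g i (f Q))⁻¹

theorem IsHorizontal.comp {f : C(Y, X)} {θ : Y → G} (h : R.IsHorizontal U g f θ) (k : C(Z, Y)) :
    R.IsHorizontal U g (f.comp k) (θ ∘ k) := fun i _ _ w hw =>
  h i (w.map k.continuous) hw

theorem IsHorizontal.inv_mul_eq [PreconnectedSpace Y] [LocallyPathConnectedSpace Y]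
    (hU : ∀ i, IsOpen (U i)) (hcov : ∀ a, ∃ i, a ∈ U i) {f : C(Y, X)} {θ θ' : Y → G}
    (h : R.IsHorizontal U g f θ) (h' : R.IsHorizontal U g f θ') (P Q : Y) :
    (θ P)⁻¹ * θ Q = (θ' P)⁻¹ * θ' Q := by
  rw [← mul_inv_eq_mul_inv_iff_inv_mul_eq]
  refine eq_of_forall_joinedIn_eq (U := fun i => f ⁻¹' U i) (f := fun y => θ y * (θ' y)⁻¹)
    (fun i => (hU i).preimage f.continuous) (fun y => hcov (f y)) (fun i P Q ⟨w, hw⟩ => ?_) P Q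
  rw [mul_inv_eq_mul_inv_iff_inv_mul_eq, h i w hw, h' i w hw]

theorem exists_isHorizontal [SimplyConnectedSpace Y] [LocallyPathConnectedSpace Y]
    (hg : ∀ i j {a b : X} (p : Path a b), (∀ t, p t ∈ U i ∩ U j) →
      g i a * R.hol p * (g i b)⁻¹ = g j a * R.hol p * (g j b)⁻¹)
    (hU : ∀ i, IsOpen (U i)) (hcov : ∀ a, ∃ i, a ∈ U i) (f : C(Y, X)) :
    ∃ θ, R.IsHorizontal U g f θ := by
  obtain ⟨y₀⟩ : Nonempty Y := inferInstance
  let h (i : ι) (y : Y) : G := R.along f y₀ y * (g i (f y))⁻¹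
  have inv_mul_h (i : ι) {P Q : Y} (w : Path P Q) :
      (h i P)⁻¹ * h i Q = g i (f P) * R.hol (w.map f.continuous) * (g i (f Q))⁻¹ := by
    rw [R.hol_eq_along f w fun _ => rfl, ← R.along_mul f P y₀ Q, ← R.along_inv f y₀ P]
    simp only [h, mul_inv_rev, inv_inv, mul_assoc]
  obtain ⟨θ, hθ⟩ := exists_forall_joinedIn_mul_inv_eq (fun i => (hU i).preimage f.continuous)
    (fun y => hcov (f y)) h fun i j P Q ⟨w, hw⟩ => by
      rw [mul_inv_eq_mul_inv_iff_inv_mul_eq, inv_mul_h, inv_mul_h]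
      exact hg j i (w.map f.continuous) fun t => (hw t).symm
  refine ⟨θ, fun i P Q w hw => ?_⟩
  rw [← mul_inv_eq_mul_inv_iff_inv_mul_eq.1 (hθ i P Q ⟨w, hw⟩), inv_mul_h]

theorem exists_glue (hg : ∀ i j {a b : X} (p : Path a b), (∀ t, p t ∈ U i ∩ U j) →
      g i a * R.hol p * (g i b)⁻¹ = g j a * R.hol p * (g j b)⁻¹)
    (hU : ∀ i, IsOpen (U i)) (hcov : ∀ a, ∃ i, a ∈ U i) :
    ∃ T : Transport X G, ∀ i {a b : X} (p : Path a b), (∀ t, p t ∈ U i) →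
      T.hol p = g i a * R.hol p * (g i b)⁻¹ := by
  choose θ hθ using fun w : C(I, X) => exists_isHorizontal hg hU hcov w
  let hol {a b : X} (p : Path a b) : G := (θ p 0)⁻¹ * θ p 1
  have hol_eq {Y : Type} [TopologicalSpace Y] {f : C(Y, X)} {η : Y → G}
      (h : R.IsHorizontal U g f η) {P Q : Y} (w : Path P Q) {a b : X} (p : Path a b)
      (hp : ∀ t, p t = f (w t)) : hol p = (η P)⁻¹ * η Q := by
    have hcomp : f.comp (w : C(I, Y)) = p := by ext t; exact (hp t).symm
    have := (hθ p).inv_mul_eq hU hcov (hcomp ▸ h.comp (w : C(I, Y))) 0 1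
    simpa [hol] using this
  have hol_refl (a : X) : hol (Path.refl a) = 1 := by
    rw [hol_eq (hθ (Path.refl a)) (Path.refl 0) (Path.refl a) fun _ => rfl, inv_mul_cancel]
  refine ⟨⟨hol, fun {a b c} p q => ?_, fun {a b p q} ⟨F⟩ => ?_⟩, fun i a b p hp => ?_⟩
  · have h := hθ (p.trans q : Path a c)
    let half : I := ⟨1 / 2, by norm_num, by norm_num⟩
    rw [hol_eq h (segPath 0 half) p fun t => (trans_apply_segPath_zero p q rfl t).symm,
      hol_eq h (segPath half 1) q fun t => (trans_apply_segPath_one p q rfl t).symm]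
    simp only [hol, mul_assoc, mul_inv_cancel_left]
  · obtain ⟨η, hη⟩ := exists_isHorizontal hg hU hcov (F : C(I × I, X))
    let row (s : I) : Path (s, (0 : I)) (s, 1) := (Path.refl s).prod (segPath 0 1)
    let edge (t : I) : Path ((0 : I), t) (1, t) := (segPath 0 1).prod (Path.refl t)
    have left : η (0, 0) = η (1, 0) := by
      rw [← inv_mul_eq_one, ← hol_eq hη (edge 0) (Path.refl a) fun t => (F.source _).symm, hol_refl]
    have right : η (0, 1) = η (1, 1) := by
      rw [← inv_mul_eq_one, ← hol_eq hη (edge 1) (Path.refl b) fun t => (F.target _).symm, hol_refl]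
    rw [hol_eq hη (row 0) p fun t => ?_, hol_eq hη (row 1) q fun t => ?_, left, right]
    · simp [row, segPath_zero_one]
    · simp [row, segPath_zero_one]
  · have h := hθ p i (segPath 0 1) fun t => show p (segPath 0 1 t) ∈ U i by
      rw [segPath_zero_one]; exact hp t
    rw [R.hol_ext (q := p) fun t => show p (segPath 0 1 t) = p t by rw [segPath_zero_one]] at h
    simpa only [ContinuousMap.coe_coe, Path.source, Path.target] using h

theorem isHorizontal_along [SimplyConnectedSpace Y] {S : Transport X G}
    (h : ∀ i {a b : X} (p : Path a b), (∀ t, p t ∈ U i) →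
      S.hol p = g i a * R.hol p * (g i b)⁻¹) (f : C(Y, X)) (P : Y) :
    R.IsHorizontal U g f (S.along f P) := fun i Q Q' w hw => by
  rw [← h i (w.map f.continuous) hw, S.along_inv, S.along_mul,
    ← S.hol_eq_along f (p := w.map f.continuous) w fun _ => rfl]

theorem hol_eq_of_forall_hol_eq {S : Transport X G} (hU : ∀ i, IsOpen (U i))
    (hcov : ∀ a, ∃ i, a ∈ U i)
    (h : ∀ i {a b : X} (p : Path a b), (∀ t, p t ∈ U i) → S.hol p = R.hol p) {a b : X}
    (p : Path a b) : S.hol p = R.hol p := by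
  have key := (isHorizontal_along (g := fun _ _ => 1) (fun i a b q hq => by
    rw [h i q hq, one_mul, inv_one, mul_one]) (p : C(I, X)) 0).inv_mul_eq hU hcov
      (isHorizontal_along (R := R) (g := fun _ _ => 1) (fun i a b q _ => by
        rw [one_mul, inv_one, mul_one]) (p : C(I, X)) 0) 0 1
  rwa [along_self, along_self, inv_one, one_mul, one_mul, ← hol_eq_along_self,
    ← hol_eq_along_self] at key

end Transport

/-! ### Conjugation of unit quaternions -/

theorem re_unitary_conj (h : SU2) (q : ℍ[ℝ]) :
    ((h : ℍ[ℝ]) * q * (h⁻¹ : SU2)).re = q.re := by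
  have re_mul_comm (a b : ℍ[ℝ]) : (a * b).re = (b * a).re := by
    simp only [Quaternion.re_mul]; ring
  rw [re_mul_comm, ← mul_assoc, ← Submonoid.coe_mul, inv_mul_cancel, Submonoid.coe_one, one_mul]

theorem im_unitary_conj (h : SU2) (q : ℍ[ℝ]) :
    ((h : ℍ[ℝ]) * q * (h⁻¹ : SU2)).im = h * q.im * (h⁻¹ : SU2) := by
  have coe_conj (r : ℝ) : (h : ℍ[ℝ]) * r * (h⁻¹ : SU2) = r := by
    rw [← Quaternion.coe_commutes, mul_assoc, ← Submonoid.coe_mul, mul_inv_cancel,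
      Submonoid.coe_one, mul_one]
  rw [← Quaternion.sub_re_self q, mul_sub, sub_mul, coe_conj, ← re_unitary_conj h q,
    Quaternion.sub_re_self]

theorem norm_unitary_conj (h : SU2) (q : ℍ[ℝ]) : ‖(h : ℍ[ℝ]) * q * (h⁻¹ : SU2)‖ = ‖q‖ := by
  rw [norm_mul, norm_mul, CStarRing.norm_coe_unitary, CStarRing.norm_coe_unitary, one_mul, mul_one]

theorem exp_unitary_conj (h : SU2) (q : ℍ[ℝ]) :
    NormedSpace.exp ((h : ℍ[ℝ]) * q * (h⁻¹ : SU2)) = h * NormedSpace.exp q * (h⁻¹ : SU2) := by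
  let _ : NormedAlgebra ℚ ℍ[ℝ] := .restrictScalars ℚ ℝ ℍ[ℝ]
  exact NormedSpace.exp_units_conj (Unitary.toUnits h) q

theorem pertMap_conj {k : ℕ} (φ : PertFun k) (h g : SU2) :
    pertMap φ (h * g * h⁻¹) = h * pertMap φ g * h⁻¹ := by
  apply Subtype.ext
  simp only [pertMap, Submonoid.coe_mul, re_unitary_conj, im_unitary_conj, norm_unitary_conj,
    ← exp_unitary_conj, mul_smul_comm, smul_mul_assoc]

theorem coe_pertMap_zpow {k : ℕ} (φ : PertFun k) (g : SU2) {α : ℝ} {Q : ℍ[ℝ]}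
    (hQ : IsUnitImag Q) (hg : (g : ℍ[ℝ]) = NormedSpace.exp (α • Q)) (ε : ℤˣ) :
    ((pertMap φ g ^ (ε : ℤ) : SU2) : ℍ[ℝ]) = NormedSpace.exp ((((ε : ℤ) : ℝ) * φ α) • Q) := by
  have h := pertMap_of_eq_exp φ g hQ hg
  rcases Int.units_eq_one_or ε with rfl | rfl
  · simpa using h
  · have h_inv : ((pertMap φ g)⁻¹ : SU2) = star (pertMap φ g : ℍ[ℝ]) := rfl
    simp [h_inv, h, NormedSpace.star_exp, Quaternion.star_eq_neg.2 hQ.1]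

theorem coe_inv_pertMap_zpow {k : ℕ} (φ : PertFun k) (g : SU2) {α : ℝ} {Q : ℍ[ℝ]}
    (hQ : IsUnitImag Q) (hg : (g : ℍ[ℝ]) = NormedSpace.exp (α • Q)) (ε : ℤˣ) :
    (((pertMap φ g ^ (ε : ℤ))⁻¹ : SU2) : ℍ[ℝ]) =
      NormedSpace.exp (-(((ε : ℤ) : ℝ) * φ α) • Q) := by
  rw [← zpow_neg, ← Units.val_neg, coe_pertMap_zpow φ g hQ hg]
  simp

/-! ### The coordinates of the collar -/

theorem cross_smul_add_smul_left (v w : EuclideanSpace ℝ (Fin 2)) (a b : ℝ) :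
    cross (a • v + b • w) v = -b * cross v w := by
  simp [cross]; ring

theorem cross_smul_add_smul_right (v w : EuclideanSpace ℝ (Fin 2)) (a b : ℝ) :
    cross (a • v + b • w) w = a * cross v w := by
  simp [cross]; ring

theorem map_eq_smul_add_smul {E L : Type*} [AddCommGroup E] [Module ℝ E] [FunLike L (ℝ × ℝ) E]
    [LinearMapClass L ℝ (ℝ × ℝ) E] (f : L) (q : ℝ × ℝ) :
    f q = q.1 • f (1, 0) + q.2 • f (0, 1) := by
  rw [← map_smul, ← map_smul, ← map_add]; simp

theorem exists_continuousLinearEquiv_of_cross_ne_zero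
    (L : (ℝ × ℝ) →L[ℝ] EuclideanSpace ℝ (Fin 2)) (h : cross (L (1, 0)) (L (0, 1)) ≠ 0) :
    ∃ L' : (ℝ × ℝ) ≃L[ℝ] EuclideanSpace ℝ (Fin 2), (L' : (ℝ × ℝ) →L[ℝ] _) = L := by
  have inj : Function.Injective L := (injective_iff_map_eq_zero L).2 fun q hq => by
    have cross_eq_zero (w : EuclideanSpace ℝ (Fin 2)) :
        cross (q.1 • L (1, 0) + q.2 • L (0, 1)) w = 0 := by
      rw [← map_eq_smul_add_smul, hq]; simp [cross]
    have h₁ := cross_eq_zero (L (0, 1))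
    have h₂ := cross_eq_zero (L (1, 0))
    rw [cross_smul_add_smul_right] at h₁
    rw [cross_smul_add_smul_left] at h₂
    exact Prod.ext ((mul_eq_zero.1 h₁).resolve_right h)
      (neg_eq_zero.1 ((mul_eq_zero.1 h₂).resolve_right h))
  exact ⟨(LinearEquiv.ofInjectiveOfFinrankEq (L : (ℝ × ℝ) →ₗ[ℝ] _) inj
    (by simp)).toContinuousLinearEquiv, rfl⟩

theorem cross_apply_one_zero (L : (ℝ × ℝ) ≃L[ℝ] EuclideanSpace ℝ (Fin 2))
    (v : EuclideanSpace ℝ (Fin 2)) :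
    cross v (L (1, 0)) = -(L.symm v).2 * cross (L (1, 0)) (L (0, 1)) := by
  rw [← cross_smul_add_smul_left _ _ (L.symm v).1, ← map_eq_smul_add_smul, L.apply_symm_apply]

namespace PertTube

variable {F : Type*} [TopologicalSpace F] [ChartedSpace (EuclideanSpace ℝ (Fin 2)) F]
  {C : EmbeddedCircle F} {x : F} (N : PertTube C x)

/-- The collar as a continuous map. -/
def collarMap : C(ℝ × ℝ, F) := ⟨N.collar, N.smooth.continuous⟩

theorem collar_add_int (p : ℝ × ℝ) (n : ℤ) : N.collar (p.1 + n, p.2) = N.collar p := by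
  have : Function.Periodic (fun s => N.collar (s, p.2)) 1 := fun s => N.periodic s p.2
  simpa using this.int_mul n p.1

/-- The collar coordinates of a point of the annulus `collar (ℝ × ℝ)`; the first one is well-defined
modulo `1`. Outside the annulus they have no meaning. -/
def coord : F → ℝ × ℝ := Function.invFun N.collar

/-- The distance from `C` in the collar coordinates, positive to the left of `C`. -/
def offset (y : F) : ℝ := (N.coord y).2

variable {N}

theorem collar_coord {y : F} (hy : y ∈ Set.range N.collar) : N.collar (N.coord y) = y :=
  Function.invFun_eq hy

variable (N)

theorem offset_collar (p : ℝ × ℝ) : N.offset (N.collar p) = p.2 :=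
  (N.injective _ _ _ _ (collar_coord (Set.mem_range_self p)).symm).1

theorem exists_coord_collar_eq (p : ℝ × ℝ) :
    ∃ n : ℤ, N.coord (N.collar p) = (p.1 + n, p.2) := by
  obtain ⟨h, n, hn⟩ := N.injective _ _ _ _ (collar_coord (Set.mem_range_self p)).symm
  exact ⟨n, Prod.ext hn h⟩

theorem mem_carrier_iff {y : F} : y ∈ C.carrier ↔ y ∈ Set.range N.collar ∧ N.offset y = 0 := by
  constructor
  · rintro ⟨s, rfl⟩
    exact ⟨⟨_, N.core s⟩, by rw [← N.core, offset_collar]⟩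
  · rintro ⟨⟨p, rfl⟩, hp⟩
    rw [offset_collar] at hp
    exact ⟨p.1, by rw [← N.core, ← hp]⟩

theorem exists_hasStrictFDerivAt_chartAt_collar (p : ℝ × ℝ) :
    ∃ L : (ℝ × ℝ) ≃L[ℝ] EuclideanSpace ℝ (Fin 2), 0 < cross (L (1, 0)) (L (0, 1)) ∧
      HasStrictFDerivAt
        (fun q => chartAt (EuclideanSpace ℝ (Fin 2)) (N.collar p) (N.collar q))
        (L : _ →L[ℝ] _) p := by
  let f q := chartAt (EuclideanSpace ℝ (Fin 2)) (N.collar p) (N.collar q)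
  have hsmooth : ContMDiffAt 𝓘(ℝ, ℝ × ℝ) 𝓘(ℝ, EuclideanSpace ℝ (Fin 2)) ∞ f p :=
    (contMDiffAt_extChartAt : ContMDiffAt (𝓡 2) _ ∞ _ (N.collar p)).comp p
      N.smooth.contMDiffAt
  have hf : HasStrictFDerivAt f (fderiv ℝ f p) p := hsmooth.contDiffAt.hasStrictFDerivAt (by simp)
  have deriv_line {l : ℝ → ℝ × ℝ} {v : ℝ × ℝ} {t : ℝ} (hl : HasDerivAt l v t) (ht : l t = p) :
      deriv (fun s => f (l s)) t = fderiv ℝ f p v :=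
    (hf.hasFDerivAt.comp_hasDerivAt_of_eq t hl ht.symm).deriv
  have hs := deriv_line ((hasDerivAt_id p.1).prodMk (hasDerivAt_const _ p.2)) rfl
  have hu := deriv_line ((hasDerivAt_const _ p.1).prodMk (hasDerivAt_id p.2)) rfl
  have hpos : 0 < cross (fderiv ℝ f p (1, 0)) (fderiv ℝ f p (0, 1)) := by
    rw [← hs, ← hu]
    exact sign_eq_one_iff.1 (N.oriented p.1 p.2)
  obtain ⟨L, hL⟩ := exists_continuousLinearEquiv_of_cross_ne_zero _ hpos.ne'
  refine ⟨L, ?_, hL ▸ hf⟩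
  rwa [← ContinuousLinearEquiv.coe_coe, hL]

theorem isOpenMap_collar : IsOpenMap N.collar := by
  refine isOpenMap_iff_nhds_le.2 fun p => ?_
  obtain ⟨L, -, hL⟩ := N.exists_hasStrictFDerivAt_chartAt_collar p
  let e := chartAt (EuclideanSpace ℝ (Fin 2)) (N.collar p)
  have mem_source : N.collar p ∈ e.source := mem_chart_source _ _
  have collar_eq : N.collar =ᶠ[𝓝 p] e.symm ∘ fun q => e (N.collar q) := by
    filter_upwards [N.smooth.continuous.continuousAt.preimage_mem_nhds
      (e.open_source.mem_nhds mem_source)] with q hq using (e.left_inv hq).symm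
  rw [map_congr collar_eq, ← map_map, hL.map_nhds_eq_of_equiv, e.symm_map_nhds_eq mem_source]

theorem continuousOn_offset : ContinuousOn N.offset (Set.range N.collar) := by
  rintro _ ⟨p, rfl⟩
  have tendsto_comp : Tendsto (N.offset ∘ N.collar) (𝓝 p) (𝓝 (N.offset (N.collar p))) := by
    rw [show N.offset ∘ N.collar = Prod.snd from funext N.offset_collar, offset_collar]
    exact continuousAt_snd
  exact ContinuousAt.continuousWithinAt
    ((tendsto_map'_iff.2 tendsto_comp).mono_left (N.isOpenMap_collar.nhds_le p))

theorem hasDerivAt_offset_comp {p : ℝ × ℝ} {L : (ℝ × ℝ) ≃L[ℝ] EuclideanSpace ℝ (Fin 2)}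
    (hL : HasStrictFDerivAt
      (fun q => chartAt (EuclideanSpace ℝ (Fin 2)) (N.collar p) (N.collar q)) (L : _ →L[ℝ] _) p)
    {w : ℝ → F} {t : ℝ} (hw : ContinuousAt w t) (ht : w t = N.collar p)
    {v : EuclideanSpace ℝ (Fin 2)}
    (hv : HasDerivAt (fun τ => chartAt (EuclideanSpace ℝ (Fin 2)) (N.collar p) (w τ)) v t) :
    HasDerivAt (fun τ => N.offset (w τ)) (L.symm v).2 t := by
  let e := chartAt (EuclideanSpace ℝ (Fin 2)) (N.collar p)
  let ψ := hL.localInverse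
  have hψ : HasDerivAt (fun τ => ψ (e (w τ))) (L.symm v) t :=
    hL.to_localInverse.hasFDerivAt.comp_hasDerivAt_of_eq t hv (congrArg e ht.symm)
  have offset_eq : ∀ᶠ y in 𝓝 (w t), N.offset y = (ψ (e y)).2 := by
    rw [ht]
    refine N.isOpenMap_collar.nhds_le p (eventually_map.2 ?_)
    filter_upwards [hL.eventually_left_inverse] with q hq
    rw [offset_collar]
    exact congrArg Prod.snd hq.symm
  exact (hasFDerivAt_snd.comp_hasDerivAt t hψ).congr_of_eventuallyEq (hw.eventually offset_eq)

theorem eventually_sign_offset {w : ℝ → F} {t s : ℝ} (hw : ContinuousAt w t) (hts : w t = C s)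
    {ε : ℤˣ} (hε : crossSign w C t s = SignType.sign (ε : ℤ)) :
    ∀ᶠ τ in 𝓝 t, SignType.sign (((ε : ℤ) : ℝ) * N.offset (w τ)) = SignType.sign (t - τ) := by
  have ht : w t = N.collar (s, 0) := hts.trans (N.core s).symm
  obtain ⟨L, hpos, hL⟩ := N.exists_hasStrictFDerivAt_chartAt_collar (s, 0)
  rw [crossSign, ht] at hε
  let e := chartAt (EuclideanSpace ℝ (Fin 2)) (N.collar (s, 0))
  have deriv_C : deriv (fun r => e (C r)) s = L (1, 0) := by
    simp only [← N.core]
    exact (hL.hasFDerivAt.comp_hasDerivAt_of_eq s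
      ((hasDerivAt_id s).prodMk (hasDerivAt_const s (0 : ℝ))) rfl).deriv
  rw [deriv_C, cross_apply_one_zero, neg_mul, Left.sign_neg, sign_mul, sign_pos hpos, mul_one]
    at hε
  have hdiff : DifferentiableAt ℝ (fun τ => e (w τ)) t := by
    refine differentiableAt_of_deriv_ne_zero fun h => ?_
    rw [h] at hε
    rcases Int.units_eq_one_or ε with rfl | rfl <;> simp at hε
  have hderiv := (N.hasDerivAt_offset_comp hL hw ht hdiff.hasDerivAt).const_mul ((ε : ℤ) : ℝ)
  refine eventually_nhdsWithin_sign_eq_of_deriv_neg ?_ (by rw [ht, offset_collar, mul_zero])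
  rw [hderiv.deriv, ← sign_eq_neg_one_iff, sign_mul, ← neg_eq_iff_eq_neg.2 hε.symm]
  rcases Int.units_eq_one_or ε with rfl | rfl <;> simp

theorem exists_isOpenEmbedding : ∃ j : AddCircle (1 : ℝ) × ℝ → F, IsOpenEmbedding j ∧
    ∀ p : ℝ × ℝ, j ((p.1 : AddCircle (1 : ℝ)), p.2) = N.collar p := by
  let π : ℝ × ℝ → AddCircle (1 : ℝ) × ℝ := Prod.map (fun s => (s : AddCircle (1 : ℝ))) id
  let j (z : AddCircle (1 : ℝ) × ℝ) : F :=
    Function.Periodic.lift (f := fun s => N.collar (s, z.2)) (fun s => N.periodic s z.2) z.1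
  have hπ : IsOpenQuotientMap π := QuotientAddGroup.isOpenQuotientMap_mk.prodMap .id
  have hj : j ∘ π = N.collar := rfl
  refine ⟨j, .of_continuous_injective_isOpenMap
    (hπ.isQuotientMap.continuous_iff.2 N.smooth.continuous) ?_ fun V hV => ?_, fun _ => rfl⟩
  · refine hπ.surjective.forall₂.2 fun p q hpq => ?_
    obtain ⟨hu, n, hn⟩ := N.injective _ _ _ _ (hpq : N.collar p = N.collar q)
    refine Prod.ext ?_ hu.symm
    change (p.1 : AddCircle (1 : ℝ)) = q.1
    rw [hn, AddCircle.coe_add, eq_comm, add_eq_left, AddCircle.coe_eq_zero_iff]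
    exact ⟨n, by simp⟩
  · rw [← Set.image_preimage_eq V hπ.surjective, ← Set.image_comp, hj]
    exact N.isOpenMap_collar _ (hV.preimage hπ.continuous)

theorem exists_path_lift {a b : F} (w : Path a b) (hw : ∀ t, w t ∈ Set.range N.collar) :
    ∃ (n : ℤ) (v : Path (N.coord a) ((N.coord b).1 + n, (N.coord b).2)),
      ∀ t, N.collar (v t) = w t := by
  obtain ⟨j, hj, hjN⟩ := N.exists_isOpenEmbedding
  have j_coord (t : I) : j (((N.coord (w t)).1 : AddCircle (1 : ℝ)), (N.coord (w t)).2) = w t :=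
    (hjN _).trans (collar_coord (hw t))
  have continuous_lift : Continuous fun t =>
      (((N.coord (w t)).1 : AddCircle (1 : ℝ)), (N.coord (w t)).2) :=
    hj.isInducing.continuous_iff.2 (w.continuous.congr fun t => (j_coord t).symm)
  obtain ⟨Γ, hΓ, hΓ₀⟩ := (AddCircle.isCoveringMap_coe (1 : ℝ)).exists_path_lifts
    ⟨_, continuous_lift.fst⟩ (N.coord (w 0)).1 rfl
  have collar_lift (t : I) : N.collar (Γ t, (N.coord (w t)).2) = w t := by
    refine (hjN _).symm.trans (Eq.trans ?_ (j_coord t))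
    exact congrArg (fun z => j (z, (N.coord (w t)).2)) (congrFun hΓ t)
  obtain ⟨-, n, hn⟩ := N.injective (N.coord b).1 (N.coord b).2 (Γ 1) (N.coord (w 1)).2 <| by
    rw [collar_lift, w.target]
    exact collar_coord (w.target ▸ hw 1)
  refine ⟨n, ⟨⟨fun t => (Γ t, (N.coord (w t)).2), Γ.continuous.prodMk continuous_lift.snd⟩,
    ?_, ?_⟩, collar_lift⟩
  · exact Prod.ext (by simpa using hΓ₀) (by simp)
  · exact Prod.ext hn (by simp)

theorem exists_crossing_interval {a b : F} {p : Path a b} {t : I} {s : ℝ} {ε : ℤˣ}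
    (h : MeetsOnce p C t s ε) : ∃ t₁ t₂ : I, t₁ < t ∧ t < t₂ ∧
      0 < ((ε : ℤ) : ℝ) * N.offset (p t₁) ∧ ((ε : ℤ) : ℝ) * N.offset (p t₂) < 0 ∧
      ∀ r ∈ Set.Icc t₁ t₂, p r ∈ Set.range N.collar := by
  have ht : p.extend t = C s := (p.extend_apply t.2).trans h.meets
  have hev : ∀ᶠ τ in 𝓝 (t : ℝ), p.extend τ ∈ Set.range N.collar ∧
      SignType.sign (((ε : ℤ) : ℝ) * N.offset (p.extend τ)) = SignType.sign (t - τ) :=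
    (p.continuous_extend.continuousAt.eventually_mem
      (N.isOpenMap_collar.isOpen_range.mem_nhds (ht ▸ ⟨_, N.core s⟩))).and
      (N.eventually_sign_offset p.continuous_extend.continuousAt ht h.sign)
  obtain ⟨δ, hδ, hball⟩ := Metric.eventually_nhds_iff_ball.1 hev
  have offset_extend : N.offset (p.extend t) = 0 := by rw [ht, ← N.core, offset_collar]
  have ne_of_ne {τ : ℝ} (hτ : τ ∈ Metric.ball (t : ℝ) δ) (hne : τ ≠ t) :
      p.extend τ ≠ p.extend t := fun he => by
    have := (hball τ hτ).2
    rw [he, offset_extend, mul_zero, sign_zero, eq_comm, sign_eq_zero_iff, sub_eq_zero] at this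
    exact hne this.symm
  have mem_ball {τ : ℝ} (h₁ : t - δ / 2 ≤ τ) (h₂ : τ ≤ t + δ / 2) : τ ∈ Metric.ball (t : ℝ) δ := by
    rw [Real.ball_eq_Ioo]; constructor <;> linarith
  have t_pos : 0 < (t : ℝ) := t.2.1.lt_of_ne fun h₀ =>
    ne_of_ne (mem_ball le_rfl (by linarith)) (by linarith) <| by
      rw [p.extend_of_le_zero (by linarith), p.extend_of_le_zero h₀.ge]
  have t_lt_one : (t : ℝ) < 1 := t.2.2.lt_of_ne fun h₁ =>
    ne_of_ne (mem_ball (by linarith) le_rfl) (by linarith) <| by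
      rw [p.extend_of_one_le (by linarith), p.extend_of_one_le h₁.ge]
  let t₁ : I := ⟨max 0 (t - δ / 2), le_max_left _ _, max_le zero_le_one (by linarith)⟩
  let t₂ : I := ⟨min 1 (t + δ / 2), le_min zero_le_one (by linarith), min_le_left _ _⟩
  have t₁_lt : (t₁ : ℝ) < t := max_lt t_pos (by linarith)
  have lt_t₂ : t < (t₂ : ℝ) := lt_min t_lt_one (by linarith)
  have near {r : I} (h₁ : t₁ ≤ r) (h₂ : r ≤ t₂) := hball r
    (mem_ball ((le_max_right _ _).trans h₁) ((show (r : ℝ) ≤ t₂ from h₂).trans (min_le_right _ _)))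
  simp only [p.extend_apply (Subtype.prop _)] at near
  refine ⟨t₁, t₂, t₁_lt, lt_t₂, ?_, ?_, fun r hr => (near hr.1 hr.2).1⟩
  · rw [← sign_eq_one_iff, (near le_rfl (t₁_lt.trans lt_t₂).le).2, sign_pos (sub_pos.2 t₁_lt)]
  · rw [← sign_eq_neg_one_iff, (near (t₁_lt.trans lt_t₂).le le_rfl).2,
      sign_neg (sub_neg.2 lt_t₂)]

end PertTube

/-! ### Holonomy around the parallels of `C` -/

namespace PertTube

variable {F G : Type*} [TopologicalSpace F] [ChartedSpace (EuclideanSpace ℝ (Fin 2)) F] [Group G]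
  {C : EmbeddedCircle F} {x : F} (N : PertTube C x) (R : Transport F G)

theorem along_collar_add_int (p q : ℝ × ℝ) (n : ℤ) :
    R.along N.collarMap (p.1 + n, p.2) (q.1 + n, q.2) = R.along N.collarMap p q :=
  R.along_map_of_comp_eq N.collarMap ⟨fun p => (p.1 + n, p.2), by fun_prop⟩
    (ContinuousMap.ext fun p => N.collar_add_int p n) p q

/-- The holonomy around the circle parallel to `C` through the point `y` of the annulus. -/
def circHol (y : F) : G :=
  R.along N.collarMap (N.coord y) ((N.coord y).1 + 1, (N.coord y).2)

theorem circHol_collar (p : ℝ × ℝ) :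
    N.circHol R (N.collar p) = R.along N.collarMap p (p.1 + 1, p.2) := by
  obtain ⟨n, hn⟩ := N.exists_coord_collar_eq p
  rw [circHol, hn, ← N.along_collar_add_int R p _ n, add_right_comm]

theorem hol_loop (s : ℝ) : R.hol (C.loop s) = N.circHol R (C s) := by
  let w : Path (s, (0 : ℝ)) (s + 1, 0) := ⟨⟨fun t => (s + t, 0), by fun_prop⟩, by simp, by simp⟩
  rw [R.hol_eq_along N.collarMap w fun t => (N.core (s + t)).symm, ← N.circHol_collar R (s, 0),
    N.core]

theorem circHol_mul_hol {a b : F} (w : Path a b) (hw : ∀ t, w t ∈ Set.range N.collar) :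
    N.circHol R a * R.hol w = R.hol w * N.circHol R b := by
  obtain ⟨n, v, hv⟩ := N.exists_path_lift w hw
  have translate := N.along_collar_add_int R (N.coord a) ((N.coord b).1 + n, (N.coord b).2) 1
  rw [Int.cast_one, add_right_comm] at translate
  rw [R.hol_eq_along N.collarMap v fun t => (hv t).symm, circHol, circHol, ← translate,
    R.along_mul, translate, ← N.along_collar_add_int R (N.coord b) _ n, R.along_mul]

variable {R} {f : G → G}

theorem map_circHol_mul_hol (hf : ∀ h g, f (h * g * h⁻¹) = h * f g * h⁻¹) {a b : F} (w : Path a b)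
    (hw : ∀ t, w t ∈ Set.range N.collar) :
    f (N.circHol R a) * R.hol w = R.hol w * f (N.circHol R b) := by
  rw [eq_mul_inv_of_mul_eq (N.circHol_mul_hol R w hw), hf, inv_mul_cancel_right]

variable (R f)

/-- The change of frame which is `f (circHol)` to the left of `C` and `1` to the right of `C`. -/
def leftGauge (y : F) : G := if 0 < N.offset y then f (N.circHol R y) else 1

variable {R f}

theorem leftGauge_of_pos {y : F} (hy : 0 < N.offset y) : N.leftGauge R f y = f (N.circHol R y) :=
  if_pos hy

theorem leftGauge_of_nonpos {y : F} (hy : N.offset y ≤ 0) : N.leftGauge R f y = 1 :=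
  if_neg hy.not_gt

theorem leftGauge_mul_hol_mul_inv (hf : ∀ h g, f (h * g * h⁻¹) = h * f g * h⁻¹) {a b : F}
    (w : Path a b) (hw : ∀ t, w t ∈ Set.range N.collar)
    (hab : 0 < N.offset a ↔ 0 < N.offset b) :
    N.leftGauge R f a * R.hol w * (N.leftGauge R f b)⁻¹ = R.hol w := by
  rw [mul_inv_eq_iff_eq_mul]
  by_cases ha : 0 < N.offset a
  · rw [leftGauge_of_pos N ha, leftGauge_of_pos N (hab.1 ha), N.map_circHol_mul_hol hf w hw]
  · rw [leftGauge, leftGauge, if_neg ha, if_neg (hab.not.1 ha), one_mul, mul_one]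

theorem offset_pos_iff_of_path {a b : F} (w : Path a b)
    (hw : ∀ t, w t ∈ Set.range N.collar \ C.carrier) : 0 < N.offset a ↔ 0 < N.offset b := by
  have ne_zero (t : I) : N.offset (w t) ≠ 0 := fun h =>
    (hw t).2 (N.mem_carrier_iff.2 ⟨(hw t).1, h⟩)
  have hc : Continuous fun t => N.offset (w t) :=
    N.continuousOn_offset.comp_continuous w.continuous fun t => (hw t).1
  have hsign : Continuous fun t => SignType.sign (N.offset (w t)) :=
    continuous_iff_continuousAt.2 fun t =>
      (continuousAt_sign_of_ne_zero (ne_zero t)).comp (f := fun t => N.offset (w t)) hc.continuousAt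
  have := PreconnectedSpace.constant (inferInstance : PreconnectedSpace I) hsign (x := 0) (y := 1)
  rw [w.source, w.target] at this
  rw [← sign_eq_one_iff, ← sign_eq_one_iff, this]

theorem leftGauge_mul_hol_mul_inv_of_crossing (hf : ∀ h g, f (h * g * h⁻¹) = h * f g * h⁻¹)
    {a b : F} (w : Path a b) (hw : ∀ t, w t ∈ Set.range N.collar) {ε : ℤˣ}
    (ha : 0 < ((ε : ℤ) : ℝ) * N.offset a) (hb : ((ε : ℤ) : ℝ) * N.offset b < 0) :
    N.leftGauge R f a * R.hol w * (N.leftGauge R f b)⁻¹ =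
      f (N.circHol R a) ^ (ε : ℤ) * R.hol w := by
  rcases Int.units_eq_one_or ε with rfl | rfl
  · have ha : 0 < N.offset a := by simpa using ha
    have hb : N.offset b < 0 := by simpa using hb
    rw [N.leftGauge_of_pos ha, N.leftGauge_of_nonpos hb.le]
    simp
  · have ha : N.offset a < 0 := by simpa using ha
    have hb : 0 < N.offset b := by simpa using hb
    rw [N.leftGauge_of_pos hb, N.leftGauge_of_nonpos ha.le, one_mul, mul_inv_eq_iff_eq_mul,
      mul_assoc, ← N.map_circHol_mul_hol hf w hw]
    simp

end PertTube

/-! ### The twisted transport -/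

theorem EmbeddedCircle.isClosed_carrier {F : Type*} [TopologicalSpace F] [T2Space F]
    [ChartedSpace (EuclideanSpace ℝ (Fin 2)) F] (C : EmbeddedCircle F) : IsClosed C.carrier := by
  have : C.carrier = C '' Set.Icc 0 (0 + 1) :=
    (Function.Periodic.image_Icc C.periodic one_pos 0).symm
  rw [this]
  exact (isCompact_Icc.image C.smooth.continuous).isClosed

namespace PertTube

variable {F G : Type*} [TopologicalSpace F] [ChartedSpace (EuclideanSpace ℝ (Fin 2)) F] [Group G]
  {C : EmbeddedCircle F} {x : F} (N : PertTube C x)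

/-- The projection of the exterior to the surface. -/
def proj : C(N.exterior, F) := ⟨fun q => q.1.1, by fun_prop⟩

theorem proj_corner : N.proj N.corner = N.collar (0, 0) :=
  congrArg (fun u => N.collar (0, u)) (by simp)

theorem proj_meridian (t : I) :
    N.proj (N.meridian t) = N.collar (0, -Real.sin (2 * Real.pi * t)) :=
  congrArg (fun u => N.collar (0, -u)) (Complex.exp_ofReal_mul_I_im _)

theorem snd_meridian (t : I) :
    (N.meridian t).1.2 = 1 / 2 + N.height * Real.cos (2 * Real.pi * t) :=
  congrArg (fun u => 1 / 2 + N.height * u) (Complex.exp_ofReal_mul_I_re _)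

theorem height_le_of_proj_mem_carrier {q : N.exterior} (h : N.proj q ∈ C.carrier) :
    N.height ≤ |q.1.2 - 1 / 2| := by
  obtain ⟨s, hs⟩ := h
  by_contra! hlt
  refine q.2.2 s (((q.1.2 - 1 / 2) / N.height : ℝ) : ℂ) ?_ (Prod.ext ?_ ?_)
  · rw [Complex.norm_real, Real.norm_eq_abs, abs_div, abs_of_pos N.height_pos,
      div_lt_one N.height_pos]
    exact hlt
  · rw [map, Complex.ofReal_im, neg_zero, N.core]
    exact hs
  · rw [map, Complex.ofReal_re, mul_div_cancel₀ _ N.height_pos.ne', add_sub_cancel]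

/-- The complement in the exterior of the cut, that is, of the vertical annulus above `C` that joins
the solid torus to the top. -/
def offCut : Set N.exterior := {q | N.proj q ∈ C.carrier → q.1.2 < 1 / 2 + N.height}

/-- A neighborhood of the cut in the exterior, lying over the collar of `C`. -/
def nearCut : Set N.exterior := {q | N.proj q ∈ Set.range N.collar ∧ 1 / 2 - N.height < q.1.2}

theorem subpath_meridian_mem_nearCut {r r' : I} (hr : r ≤ r')
    (h : ∀ t ∈ Set.Icc r r', 0 ≤ Real.cos (2 * Real.pi * t)) (τ : I) :
    N.meridian.subpath r r' τ ∈ N.nearCut := by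
  refine ⟨(N.proj_meridian _).symm ▸ Set.mem_range_self _, ?_⟩
  change _ < (N.meridian (segPath r r' τ)).1.2
  rw [snd_meridian]
  nlinarith [N.height_pos, h _ (segPath_mem_Icc hr τ)]

theorem subpath_meridian_mem_offCut {r r' : I} (hr : r ≤ r')
    (h : ∀ t ∈ Set.Icc r r', Real.cos (2 * Real.pi * t) ≤ 0) (τ : I) :
    N.meridian.subpath r r' τ ∈ N.offCut := fun _ => by
  change (N.meridian (segPath r r' τ)).1.2 < _
  rw [snd_meridian]
  nlinarith [N.height_pos, h _ (segPath_mem_Icc hr τ)]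

theorem isOpen_offCut [T2Space F] : IsOpen N.offCut := by
  have : N.offCut = (N.proj ⁻¹' C.carrier ∩ {q | 1 / 2 + N.height ≤ q.1.2})ᶜ := by
    ext q; simp [offCut]
  rw [this]
  exact ((C.isClosed_carrier.preimage N.proj.continuous).inter
    (isClosed_le continuous_const (by fun_prop))).isOpen_compl

theorem isOpen_nearCut : IsOpen N.nearCut :=
  (N.isOpenMap_collar.isOpen_range.preimage N.proj.continuous).inter
    (isOpen_lt continuous_const (continuous_snd.comp continuous_subtype_val))

theorem mem_offCut_or_mem_nearCut (q : N.exterior) : q ∈ N.offCut ∨ q ∈ N.nearCut := by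
  refine or_iff_not_imp_left.2 fun h => ?_
  obtain ⟨hC, hq⟩ := Classical.not_imp.1 h
  exact ⟨(N.mem_carrier_iff.1 hC).1, by linarith [N.height_pos]⟩

theorem proj_notMem_carrier {q : N.exterior} (h : q ∈ N.offCut) (h' : q ∈ N.nearCut) :
    N.proj q ∉ C.carrier := fun hC => by
  rcases le_abs.1 (N.height_le_of_proj_mem_carrier hC) with hq | hq <;> linarith [h hC, h'.2]

variable (R : Transport F G) (f : G → G)

/-- `T` is the transport of the exterior that is obtained from the constant extension of `R` by
changing the frame by `leftGauge` along the cut. -/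
structure IsTwist (T : Transport N.exterior G) : Prop where
  hol_of_mem_offCut : ∀ {a b : N.exterior} (p : Path a b), (∀ t, p t ∈ N.offCut) →
    T.hol p = (R.comap N.proj).hol p
  hol_of_mem_nearCut : ∀ {a b : N.exterior} (p : Path a b), (∀ t, p t ∈ N.nearCut) →
    T.hol p = N.leftGauge R f (N.proj a) * (R.comap N.proj).hol p *
      (N.leftGauge R f (N.proj b))⁻¹

variable {R f} {T : Transport N.exterior G} (hf : ∀ h g, f (h * g * h⁻¹) = h * f g * h⁻¹)

include hf in
theorem exists_isTwist [T2Space F] : ∃ T : Transport N.exterior G, N.IsTwist R f T := by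
  have overlap {a b : N.exterior} (p : Path a b) (hoff : ∀ t, p t ∈ N.offCut)
      (hnear : ∀ t, p t ∈ N.nearCut) :
      N.leftGauge R f (N.proj a) * (R.comap N.proj).hol p * (N.leftGauge R f (N.proj b))⁻¹ =
        (R.comap N.proj).hol p := by
    refine N.leftGauge_mul_hol_mul_inv hf (p.map N.proj.continuous) (fun t => (hnear t).1) ?_
    exact N.offset_pos_iff_of_path (p.map N.proj.continuous) fun t =>
      ⟨(hnear t).1, N.proj_notMem_carrier (hoff t) (hnear t)⟩
  let U (near : Bool) : Set N.exterior := bif near then N.nearCut else N.offCut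
  let g (near : Bool) (q : N.exterior) : G := bif near then N.leftGauge R f (N.proj q) else 1
  obtain ⟨T, hT⟩ := Transport.exists_glue (R := R.comap N.proj) (U := U) (g := g)
    (fun i j a b p hp => by
      cases i <;> cases j <;> simp only [g, cond_true, cond_false, one_mul, inv_one, mul_one]
      · exact (overlap p (fun t => (hp t).1) fun t => (hp t).2).symm
      · exact overlap p (fun t => (hp t).2) fun t => (hp t).1)
    (Bool.forall_bool.2 ⟨N.isOpen_offCut, N.isOpen_nearCut⟩)
    fun q => Bool.exists_bool.2 (N.mem_offCut_or_mem_nearCut q)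
  exact ⟨T, fun p hp => by simpa [g] using hT false p hp, hT true⟩

namespace IsTwist

variable {N} (hT : N.IsTwist R f T)
include hT

theorem hol_comap_inclBottom {a b : F} (p : Path a b) : (T.comap N.inclBottom).hol p = R.hol p :=
  hT.hol_of_mem_offCut _ fun _ _ => show (0 : ℝ) < _ by linarith [N.height_pos]

theorem hol_vertical : T.hol N.vertical = 1 := by
  rw [hT.hol_of_mem_offCut _ fun t h => ?_]
  · exact R.hol_refl x
  · obtain ⟨s, hs⟩ := h
    exact absurd ((N.core s).trans hs) (N.base_notMem s 0 (by simp))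

theorem hol_comap_inclTop_of_disjoint {a b : F} {p : Path a b}
    (hp : Disjoint C.carrier (Set.range p)) : (T.comap N.inclTop).hol p = R.hol p :=
  hT.hol_of_mem_offCut _ fun t h => absurd (Set.mem_range_self t) (Set.disjoint_left.1 hp h)

theorem hol_comap_inclTop_of_mem_range_collar {a b : F} (p : Path a b)
    (hp : ∀ t, p t ∈ Set.range N.collar) :
    (T.comap N.inclTop).hol p = N.leftGauge R f a * R.hol p * (N.leftGauge R f b)⁻¹ :=
  hT.hol_of_mem_nearCut _ fun t => ⟨hp t, show _ < (1 : ℝ) by linarith [N.height_pos]⟩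

theorem hol_longitude : T.hol N.longitude = N.circHol R (N.proj N.corner) := by
  have hnear (t : I) : N.longitude t ∈ N.nearCut :=
    ⟨⟨_, rfl⟩, show _ < 1 / 2 + N.height * (1 : ℝ) by linarith [N.height_pos]⟩
  let w : Path ((0 : ℝ), (0 : ℝ)) (1, 0) := ⟨⟨fun t => (t, 0), by fun_prop⟩, by simp, by simp⟩
  rw [hT.hol_of_mem_nearCut _ hnear, N.proj_corner, N.leftGauge_of_nonpos (N.offset_collar _).le,
    inv_one, mul_one, one_mul, circHol_collar, zero_add]
  exact R.hol_eq_along N.collarMap w fun t => congrArg (fun u => N.collar (t, u)) (by simp)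

theorem hol_meridian_subpath_zero_left {r : I} (hr : (r : ℝ) = 1 / 4) :
    T.hol (N.meridian.subpath 0 r) = (R.comap N.proj).hol (N.meridian.subpath 0 r) := by
  have h : N.offset (N.proj (N.meridian r)) ≤ 0 := by
    rw [proj_meridian, offset_collar, show 2 * Real.pi * r = Real.pi / 2 by rw [hr]; ring,
      Real.sin_pi_div_two]
    norm_num
  rw [hT.hol_of_mem_nearCut _ (N.subpath_meridian_mem_nearCut r.2.1 fun t ht => ?_),
    N.leftGauge_of_nonpos h, N.leftGauge_of_nonpos, one_mul, inv_one, mul_one]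
  · rw [proj_meridian, offset_collar]
    simp
  · have htr : (t : ℝ) ≤ 1 / 4 := hr ▸ ht.2
    exact Real.cos_nonneg_of_mem_Icc
      ⟨by nlinarith [Real.pi_pos, t.2.1], by nlinarith [Real.pi_pos]⟩

theorem hol_meridian_subpath_of_cos_nonpos {r r' : I} (hr : (r : ℝ) = 1 / 4)
    (hr' : (r' : ℝ) = 3 / 4) :
    T.hol (N.meridian.subpath r r') = (R.comap N.proj).hol (N.meridian.subpath r r') := by
  have hrr' : r ≤ r' := show (r : ℝ) ≤ r' by rw [hr, hr']; norm_num
  refine hT.hol_of_mem_offCut _ (N.subpath_meridian_mem_offCut hrr' fun t ht => ?_)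
  have htr : 1 / 4 ≤ (t : ℝ) := hr ▸ ht.1
  have htr' : (t : ℝ) ≤ 3 / 4 := hr' ▸ ht.2
  exact Real.cos_nonpos_of_pi_div_two_le_of_le (by nlinarith [Real.pi_pos])
    (by nlinarith [Real.pi_pos])

include hf

theorem hol_meridian_subpath_one_right {r : I} (hr : (r : ℝ) = 3 / 4) :
    T.hol (N.meridian.subpath r 1) =
      (R.comap N.proj).hol (N.meridian.subpath r 1) *
        f (N.circHol R (N.proj (N.meridian 1))) := by
  have hnear := N.subpath_meridian_mem_nearCut (r := r) (r' := 1) r.2.2 fun t ht => by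
    have htr : 3 / 4 ≤ (t : ℝ) := hr ▸ ht.1
    rw [← Real.cos_sub_two_pi]
    exact Real.cos_nonneg_of_mem_Icc
      ⟨by nlinarith [Real.pi_pos], by nlinarith [Real.pi_pos, t.2.2]⟩
  have h : 0 < N.offset (N.proj (N.meridian r)) := by
    rw [proj_meridian, offset_collar,
      show 2 * Real.pi * r = Real.pi / 2 + Real.pi by rw [hr]; ring,
      Real.sin_add_pi, Real.sin_pi_div_two]
    norm_num
  have h₁ : N.offset (N.proj (N.meridian 1)) ≤ 0 := by
    rw [proj_meridian, offset_collar]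
    simp
  rw [hT.hol_of_mem_nearCut _ hnear, N.leftGauge_of_pos h, N.leftGauge_of_nonpos h₁, inv_one,
    mul_one]
  exact N.map_circHol_mul_hol hf ((N.meridian.subpath r 1).map N.proj.continuous)
    fun t => (hnear t).1

theorem hol_meridian : T.hol N.meridian = f (T.hol N.longitude) := by
  let r₁ : I := ⟨1 / 4, by norm_num, by norm_num⟩
  let r₃ : I := ⟨3 / 4, by norm_num, by norm_num⟩
  have hol_comap_meridian : (R.comap N.proj).hol N.meridian = 1 := by
    let w : Path ((0 : ℝ), (0 : ℝ)) (0, 0) :=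
      ⟨⟨fun t => (0, -Real.sin (2 * Real.pi * t)), by fun_prop⟩, by simp, by simp⟩
    rw [← R.along_self N.collarMap (0, 0)]
    exact R.hol_eq_along N.collarMap w N.proj_meridian
  rw [T.hol_eq_subpath_mul_subpath _ r₃, ← T.hol_subpath_mul_subpath _ 0 r₁ r₃,
    hT.hol_meridian_subpath_zero_left rfl, hT.hol_meridian_subpath_of_cos_nonpos rfl rfl,
    hT.hol_meridian_subpath_one_right hf rfl, Transport.hol_subpath_mul_subpath, ← mul_assoc,
    ← Transport.hol_eq_subpath_mul_subpath, hol_comap_meridian, one_mul, N.meridian.target,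
    hT.hol_longitude]

theorem hol_comap_inclTop_of_meetsOnce {a b : F} {p : Path a b} {t : I} {s : ℝ} {ε : ℤˣ}
    (h : MeetsOnce p C t s ε) :
    (T.comap N.inclTop).hol p = f (R.hol (p.subpath 0 t) * R.hol (C.loop s) *
      (R.hol (p.subpath 0 t))⁻¹) ^ (ε : ℤ) * R.hol p := by
  obtain ⟨t₁, t₂, ht₁, ht₂, h₁, h₂, hcollar⟩ := N.exists_crossing_interval h
  have disjoint {r r' : I} (ht : t ∉ Set.uIcc r r') :
      Disjoint C.carrier (Set.range (p.subpath r r')) := by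
    rw [Path.range_subpath, Set.disjoint_right]
    rintro _ ⟨τ, hτ, rfl⟩ hC
    exact ht (h.unique τ hC ▸ hτ)
  have h₁₂ := (ht₁.trans ht₂).le
  have circHol_mul_hol : N.circHol R (p t₁) * R.hol (p.subpath t₁ t) =
      R.hol (p.subpath t₁ t) * R.hol (C.loop s) := by
    rw [N.hol_loop, ← h.meets, N.circHol_mul_hol]
    exact fun τ => hcollar _ (Set.Icc_subset_Icc_right ht₂.le (segPath_mem_Icc ht₁.le τ))
  have circHol_conj : R.hol (p.subpath 0 t) * R.hol (C.loop s) * (R.hol (p.subpath 0 t))⁻¹ =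
      R.hol (p.subpath 0 t₁) * N.circHol R (p t₁) * (R.hol (p.subpath 0 t₁))⁻¹ := by
    rw [← R.hol_subpath_mul_subpath p 0 t₁ t, mul_assoc (R.hol _), ← circHol_mul_hol]
    group
  rw [circHol_conj, hf, conj_zpow, Transport.hol_eq_subpath_mul_subpath _ p t₂,
    ← Transport.hol_subpath_mul_subpath _ p 0 t₁ t₂,
    hT.hol_comap_inclTop_of_disjoint (disjoint fun ht => ?_),
    hT.hol_comap_inclTop_of_mem_range_collar (p.subpath t₁ t₂)
      fun τ => hcollar _ (segPath_mem_Icc h₁₂ τ),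
    hT.hol_comap_inclTop_of_disjoint (disjoint fun ht => ?_),
    N.leftGauge_mul_hol_mul_inv_of_crossing hf (p.subpath t₁ t₂)
      (fun τ => hcollar _ (segPath_mem_Icc h₁₂ τ)) h₁ h₂,
    R.hol_eq_subpath_mul_subpath p t₂, ← R.hol_subpath_mul_subpath p 0 t₁ t₂]
  · group
  · rw [Set.uIcc_of_le (show t₂ ≤ 1 from t₂.2.2)] at ht
    exact ht.1.not_gt ht₂
  · rw [Set.uIcc_of_le (show 0 ≤ t₁ from t₁.2.1)] at ht
    exact ht.2.not_gt ht₁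

theorem hol_comap_inclTop_connect_of_meetsOnce_loop {a : F} {γ : Path x a} {E : Path a a} {t : I}
    {s : ℝ} {ε : ℤˣ} (h : MeetsOnce E C t s ε) (hγ : Disjoint C.carrier (Set.range γ)) :
    (T.comap N.inclTop).hol (connect γ E) =
      f (R.hol (longitudeLoop C γ E h.meets)) ^ (ε : ℤ) * R.hol (connect γ E) := by
  have longitude_eq : R.hol (longitudeLoop C γ E h.meets) = R.hol γ *
      (R.hol (E.subpath 0 t) * R.hol (C.loop s) * (R.hol (E.subpath 0 t))⁻¹) * (R.hol γ)⁻¹ := by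
    rw [longitudeLoop, R.hol_connect, R.hol_trans, R.hol_cast]
    group
  rw [longitude_eq, hf, conj_zpow, Transport.hol_connect, hT.hol_comap_inclTop_of_disjoint hγ,
    hT.hol_comap_inclTop_of_meetsOnce hf h, R.hol_connect]
  group

theorem hol_comap_inclTop_connect_of_meetsOnce_arc {a : F} {γ : Path x a} {E : Path a a} {t : I}
    {s : ℝ} {ε : ℤˣ} (h : MeetsOnce γ C t s ε) (hE : Disjoint C.carrier (Set.range E)) :
    (T.comap N.inclTop).hol (connect γ E) =
      f (R.hol (longitudeArc C γ h.meets)) ^ (ε : ℤ) * R.hol (connect γ E) *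
        (f (R.hol (longitudeArc C γ h.meets)) ^ (ε : ℤ))⁻¹ := by
  have hγ := hT.hol_comap_inclTop_of_meetsOnce hf h
  rw [longitudeArc, R.hol_connect, R.hol_cast, Transport.hol_connect, hγ,
    hT.hol_comap_inclTop_of_disjoint hE, R.hol_connect]
  group

end IsTwist

end PertTube

/-! ### The two sides of the solid torus -/

namespace PertTube

variable {F G : Type*} [TopologicalSpace F] [ChartedSpace (EuclideanSpace ℝ (Fin 2)) F] [Group G]
  {C : EmbeddedCircle F} {x : F} (N : PertTube C x)

/-- Half of the width of the solid torus at the height `t`. Above and below the solid torus it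
vanishes, as the square root of a negative number is `0`. -/
def halfWidth (t : ℝ) : ℝ := √(1 - ((t - 1 / 2) / N.height) ^ 2)

theorem halfWidth_le_one (t : ℝ) : N.halfWidth t ≤ 1 := by
  rw [halfWidth, Real.sqrt_le_left zero_le_one]
  linarith [sq_nonneg ((t - 1 / 2) / N.height)]

theorem halfWidth_eq_zero {t : ℝ} (h : N.height ≤ |t - 1 / 2|) : N.halfWidth t = 0 := by
  have : 1 ≤ ((t - 1 / 2) / N.height) ^ 2 := by
    rwa [one_le_sq_iff_one_le_abs, abs_div, abs_of_pos N.height_pos, one_le_div N.height_pos]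
  exact Real.sqrt_eq_zero'.2 (by linarith)

theorem halfWidth_add_mul_cos (θ : ℝ) :
    N.halfWidth (1 / 2 + N.height * Real.cos θ) = |Real.sin θ| := by
  rw [halfWidth, add_sub_cancel_left, mul_div_cancel_left₀ _ N.height_pos.ne', ← Real.sin_sq,
    Real.sqrt_sq_eq_abs]

theorem continuous_halfWidth : Continuous N.halfWidth := by
  unfold halfWidth
  fun_prop

theorem mem_exterior_of_halfWidth_le {s u t : ℝ} (ht : t ∈ Set.Icc (0 : ℝ) 1)
    (h : N.halfWidth t ≤ |u|) : (N.collar (s, u), t) ∈ N.exterior := by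
  refine ⟨ht, fun s' z hz he => ?_⟩
  have him : u = -z.im := (N.injective _ _ _ _ (congrArg Prod.fst he)).1
  have hre : z.re = (t - 1 / 2) / N.height := by
    have hz_height : 1 / 2 + N.height * z.re = t := congrArg Prod.snd he
    rw [← hz_height, add_sub_cancel_left, mul_div_cancel_left₀ _ N.height_pos.ne']
  rw [halfWidth, ← hre, him, abs_neg, Real.sqrt_le_left (abs_nonneg _), sq_abs] at h
  have hz : ‖z‖ ^ 2 < 1 := (sq_lt_one_iff₀ (norm_nonneg z)).2 hz
  rw [Complex.sq_norm, Complex.normSq_apply] at hz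
  linarith

/-- A cutoff function of the height, equal to `1` on the solid torus and to `0` at both ends of the
cylinder. -/
def cutoff (t : ℝ) : ℝ := min 1 ((1 / 2 - |t - 1 / 2|) / (1 / 2 - N.height))

theorem cutoff_of_le {t : ℝ} (h : |t - 1 / 2| ≤ N.height) : N.cutoff t = 1 :=
  min_eq_left ((one_le_div (sub_pos.2 N.height_lt)).2 (by linarith))

theorem cutoff_zero : N.cutoff 0 = 0 := by
  norm_num [cutoff]

theorem cutoff_one : N.cutoff 1 = 0 := by
  norm_num [cutoff]

/-- At the height `t`, the line of the collar coordinates `u` is pushed to the side `e` of the solid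
torus. -/
def sideCoord (e : ℤˣ) (t u : ℝ) : ℝ :=
  u + (e : ℤ) * (N.cutoff t * max (N.halfWidth t - (e : ℤ) * u) 0)

theorem halfWidth_le_abs_sideCoord (e : ℤˣ) (t u : ℝ) : N.halfWidth t ≤ |N.sideCoord e t u| := by
  rcases le_total |t - 1 / 2| N.height with h | h
  · rw [le_abs, sideCoord, N.cutoff_of_le h, one_mul]
    rcases Int.units_eq_one_or e with rfl | rfl
    · left
      have := le_max_left (N.halfWidth t - ((1 : ℤˣ) : ℤ) * u) 0
      push_cast at this ⊢
      linarith
    · right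
      have := le_max_left (N.halfWidth t - ((-1 : ℤˣ) : ℤ) * u) 0
      push_cast at this ⊢
      linarith
  · rw [N.halfWidth_eq_zero h]
    exact abs_nonneg _

theorem sideCoord_of_le {e : ℤˣ} {t u : ℝ} (h : N.halfWidth t ≤ (e : ℤ) * u) :
    N.sideCoord e t u = u := by
  rw [sideCoord, max_eq_right (sub_nonpos.2 h), mul_zero, mul_zero, add_zero]

theorem sideCoord_zero (e : ℤˣ) (t : ℝ) : N.sideCoord e t 0 = (e : ℤ) * N.halfWidth t := by
  rw [sideCoord, mul_zero, sub_zero, zero_add,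
    max_eq_left (show 0 ≤ N.halfWidth t from Real.sqrt_nonneg _)]
  rcases le_total |t - 1 / 2| N.height with h | h
  · rw [N.cutoff_of_le h, one_mul]
  · rw [N.halfWidth_eq_zero h, mul_zero]

/-- The product of the collar with the interval, pushed to the side `e` of the solid torus. -/
def sideMap (e : ℤˣ) : C((ℝ × ℝ) × I, N.exterior) where
  toFun p := ⟨(N.collar (p.1.1, N.sideCoord e p.2 p.1.2), p.2),
    N.mem_exterior_of_halfWidth_le p.2.2 (N.halfWidth_le_abs_sideCoord e _ _)⟩
  continuous_toFun := by
    have continuous_collar := N.smooth.continuous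
    have continuous_halfWidth := N.continuous_halfWidth
    unfold sideCoord cutoff
    fun_prop

theorem sideMap_zero (e : ℤˣ) (p : ℝ × ℝ) : N.sideMap e (p, 0) = N.inclBottom (N.collar p) :=
  Subtype.ext (Prod.ext (congrArg (fun u => N.collar (p.1, u)) (by simp [sideCoord, cutoff_zero]))
    rfl)

theorem sideMap_one (e : ℤˣ) (p : ℝ × ℝ) : N.sideMap e (p, 1) = N.inclTop (N.collar p) :=
  Subtype.ext (Prod.ext (congrArg (fun u => N.collar (p.1, u)) (by simp [sideCoord, cutoff_one]))
    rfl)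

theorem sideMap_eq_of_height_le {t : I} (ht : N.height ≤ |(t : ℝ) - 1 / 2|) (e e' : ℤˣ) (s : ℝ) :
    N.sideMap e ((s, 0), t) = N.sideMap e' ((s, 0), t) :=
  Subtype.ext (Prod.ext (congrArg (fun u => N.collar (s, u))
    (by simp only [sideCoord_zero, N.halfWidth_eq_zero ht, mul_zero])) rfl)

/-- The height in the cylinder. -/
def heightMap : C(N.exterior, I) := ⟨fun q => ⟨q.1.2, q.2.1⟩, by fun_prop⟩

theorem coe_heightMap_corner : (N.heightMap N.corner : ℝ) = 1 / 2 + N.height := by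
  simp [heightMap, corner, map]

theorem meridian_eq_sideMap {e : ℤˣ} {t : I} (h : (e : ℤ) * Real.sin (2 * Real.pi * t) ≤ 0) :
    N.meridian t = N.sideMap e ((0, 0), N.heightMap (N.meridian t)) := by
  refine Subtype.ext (Prod.ext ((N.proj_meridian t).trans
    (congrArg (fun u => N.collar (0, u)) ?_)) rfl)
  change _ = N.sideCoord e (N.meridian t).1.2 0
  rw [sideCoord_zero, snd_meridian, halfWidth_add_mul_cos]
  rcases Int.units_eq_one_or e with rfl | rfl
  · rw [abs_of_nonpos (by simpa using h)]
    simp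
  · rw [abs_of_nonneg (by simpa using h)]
    simp

variable (S : Transport N.exterior G)

theorem hol_meridian_eq_along_mul_along (r : I) (hr : (r : ℝ) = 1 / 2) :
    S.hol N.meridian =
      S.along (N.sideMap (-1)) ((0, 0), N.heightMap N.corner) ((0, 0), N.heightMap (N.meridian r)) *
      S.along (N.sideMap 1) ((0, 0), N.heightMap (N.meridian r))
        ((0, 0), N.heightMap N.corner) := by
  let L : C(I, (ℝ × ℝ) × I) :=
    (ContinuousMap.const I ((0 : ℝ), (0 : ℝ))).prodMk (N.heightMap.comp N.meridian)
  have left := S.hol_subpath_eq_along (N.sideMap (-1)) N.meridian (show 0 ≤ r from r.2.1) L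
    fun t ht => N.meridian_eq_sideMap (by
      have htr : (t : ℝ) ≤ 1 / 2 := hr ▸ ht.2
      have := Real.sin_nonneg_of_nonneg_of_le_pi (x := 2 * Real.pi * t)
        (by have := t.2.1; positivity) (by nlinarith [Real.pi_pos])
      simpa using this)
  have right := S.hol_subpath_eq_along (N.sideMap 1) N.meridian (show r ≤ 1 from r.2.2) L
    fun t ht => N.meridian_eq_sideMap (by
      have htr : 1 / 2 ≤ (t : ℝ) := hr ▸ ht.1
      have := Real.sin_nonneg_of_nonneg_of_le_pi (x := 2 * Real.pi * t - Real.pi)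
        (by nlinarith [Real.pi_pos]) (by nlinarith [Real.pi_pos, t.2.2])
      rw [Real.sin_sub_pi] at this
      simpa using this)
  have source : L 0 = ((0, 0), N.heightMap N.corner) :=
    congrArg (fun q => ((0, 0), N.heightMap q)) N.meridian.source
  have target : L 1 = ((0, 0), N.heightMap N.corner) :=
    congrArg (fun q => ((0, 0), N.heightMap q)) N.meridian.target
  rw [S.hol_eq_subpath_mul_subpath _ r, left, right, source, target]
  rfl

theorem hol_longitude_eq_along (e : ℤˣ) : S.hol N.longitude =
    S.along (N.sideMap e) ((0, 0), N.heightMap N.corner) ((1, 0), N.heightMap N.corner) := by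
  let w : Path ((0 : ℝ), (0 : ℝ)) (1, 0) := ⟨⟨fun t => (t, 0), by fun_prop⟩, by simp, by simp⟩
  refine S.hol_eq_along (N.sideMap e) (w.prod (Path.refl _)) fun t => Subtype.ext (Prod.ext ?_ rfl)
  have hheight : N.height ≤ |(N.heightMap N.corner : ℝ) - 1 / 2| := by
    rw [coe_heightMap_corner, add_sub_cancel_left]
    exact le_abs_self _
  change N.collar (t, -(1 : ℂ).im) = N.collar (t, N.sideCoord e (N.heightMap N.corner) 0)
  rw [sideCoord_zero, N.halfWidth_eq_zero hheight, mul_zero, Complex.one_im, neg_zero]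

theorem along_sideMap_zero (e : ℤˣ) (p q : ℝ × ℝ) :
    S.along (N.sideMap e) (p, 0) (q, 0) = (S.comap N.inclBottom).along N.collarMap p q := by
  have hcomp : (N.sideMap e).comp ((ContinuousMap.id _).prodMk (.const _ 0)) =
      N.inclBottom.comp N.collarMap := ContinuousMap.ext (N.sideMap_zero e)
  exact (S.along_comp (N.sideMap e) ((ContinuousMap.id _).prodMk (.const _ 0)) p q).symm.trans
    (hcomp ▸ rfl)

theorem along_sideMap_one (e : ℤˣ) (p q : ℝ × ℝ) :
    S.along (N.sideMap e) (p, 1) (q, 1) = (S.comap N.inclTop).along N.collarMap p q := by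
  have hcomp : (N.sideMap e).comp ((ContinuousMap.id _).prodMk (.const _ 1)) =
      N.inclTop.comp N.collarMap := ContinuousMap.ext (N.sideMap_one e)
  exact (S.along_comp (N.sideMap e) ((ContinuousMap.id _).prodMk (.const _ 1)) p q).symm.trans
    (hcomp ▸ rfl)

theorem along_sideMap_add_int (e : ℤˣ) (p q : ℝ × ℝ) (t t' : I) (n : ℤ) :
    S.along (N.sideMap e) ((p.1 + n, p.2), t) ((q.1 + n, q.2), t') =
      S.along (N.sideMap e) (p, t) (q, t') :=
  S.along_map_of_comp_eq (N.sideMap e)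
    ⟨fun p : (ℝ × ℝ) × I => ((p.1.1 + n, p.1.2), p.2), by fun_prop⟩
    (ContinuousMap.ext fun p => Subtype.ext <| Prod.ext
      (N.collar_add_int (p.1.1, N.sideCoord e p.2 p.1.2) n) rfl) (p, t) (q, t')

/-- The transport from the bottom to the top over the point `y` of the collar, along the side `e` of
the solid torus. -/
def sideHol (e : ℤˣ) (y : F) : G := S.along (N.sideMap e) (N.coord y, 0) (N.coord y, 1)

theorem sideHol_collar (e : ℤˣ) (p : ℝ × ℝ) :
    N.sideHol S e (N.collar p) = S.along (N.sideMap e) (p, 0) (p, 1) := by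
  obtain ⟨n, hn⟩ := N.exists_coord_collar_eq p
  rw [sideHol, hn, along_sideMap_add_int]

theorem sideHol_mul_hol (e : ℤˣ) {a b : F} (w : Path a b) (hw : ∀ t, w t ∈ Set.range N.collar) :
    N.sideHol S e a * (S.comap N.inclTop).hol w =
      (S.comap N.inclBottom).hol w * N.sideHol S e b := by
  obtain ⟨n, v, hv⟩ := N.exists_path_lift w hw
  rw [Transport.hol_eq_along _ N.collarMap v fun t => (hv t).symm,
    Transport.hol_eq_along _ N.collarMap v fun t => (hv t).symm, sideHol, sideHol,
    ← N.along_sideMap_add_int S e (N.coord b) (N.coord b) 0 1 n, ← N.along_sideMap_zero S e,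
    ← N.along_sideMap_one S e, S.along_mul, S.along_mul]

end PertTube

/-! ### Uniqueness of the twisted transport -/

namespace PertTube

variable {F G : Type*} [TopologicalSpace F] [ChartedSpace (EuclideanSpace ℝ (Fin 2)) F] [Group G]
  {C : EmbeddedCircle F} {x : F} (N : PertTube C x) (S : Transport N.exterior G) {f : G → G}

theorem along_sideMap_eq_of_height_le (e e' : ℤˣ) {t t' : I} (htt' : t ≤ t')
    (h : ∀ r ∈ Set.Icc t t', N.height ≤ |(r : ℝ) - 1 / 2|) :
    S.along (N.sideMap e) ((0, 0), t) ((0, 0), t') =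
      S.along (N.sideMap e') ((0, 0), t) ((0, 0), t') :=
  S.along_eq_of_forall_eq ((Path.refl _).prod (segPath t t')) fun r =>
    N.sideMap_eq_of_height_le (h _ (segPath_mem_Icc htt' r)) e e' 0

theorem circHol_comap_inclBottom_collar_zero :
    N.circHol (S.comap N.inclBottom) (N.collar (0, 0)) =
      S.along (N.sideMap 1) ((0, 0), 0) ((0, 0), N.heightMap N.corner) * S.hol N.longitude *
        (S.along (N.sideMap 1) ((0, 0), 0) ((0, 0), N.heightMap N.corner))⁻¹ := by
  have translate := N.along_sideMap_add_int S 1 (0, 0) (0, 0) 0 (N.heightMap N.corner) 1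
  rw [Int.cast_one, zero_add] at translate
  rw [circHol_collar, zero_add, ← N.along_sideMap_zero S 1, N.hol_longitude_eq_along S 1,
    ← S.along_mul (N.sideMap 1) ((0, 0), 0) ((1, 0), N.heightMap N.corner) ((1, 0), 0),
    ← S.along_inv (N.sideMap 1) ((1, 0), 0) ((1, 0), N.heightMap N.corner), translate,
    ← S.along_mul (N.sideMap 1) ((0, 0), 0) ((0, 0), N.heightMap N.corner)
      ((1, 0), N.heightMap N.corner)]

variable {S} (hf : ∀ h g, f (h * g * h⁻¹) = h * f g * h⁻¹)
  (hS : S.hol N.meridian = f (S.hol N.longitude))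
include hf hS

theorem sideHol_one_collar_zero :
    N.sideHol S 1 (N.collar (0, 0)) =
      f (N.circHol (S.comap N.inclBottom) (N.collar (0, 0))) *
        N.sideHol S (-1) (N.collar (0, 0)) := by
  let r : I := ⟨1 / 2, by norm_num, by norm_num⟩
  let hi := N.heightMap N.corner
  let lo := N.heightMap (N.meridian r)
  let A (e : ℤˣ) (t t' : I) : G := S.along (N.sideMap e) ((0, 0), t) ((0, 0), t')
  have coe_lo : (lo : ℝ) = 1 / 2 - N.height := by
    refine (N.snd_meridian r).trans ?_
    rw [show 2 * Real.pi * (r : ℝ) = Real.pi by simp [r]; ring, Real.cos_pi]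
    ring
  have below : A 1 0 lo = A (-1) 0 lo :=
    N.along_sideMap_eq_of_height_le S 1 (-1) lo.2.1 fun t ht => by
      have : (t : ℝ) ≤ 1 / 2 - N.height := coe_lo ▸ ht.2
      exact le_abs.2 (.inr (by linarith))
  have above : A 1 hi 1 = A (-1) hi 1 :=
    N.along_sideMap_eq_of_height_le S 1 (-1) hi.2.2 fun t ht => by
      have : 1 / 2 + N.height ≤ (t : ℝ) := N.coe_heightMap_corner ▸ ht.1
      exact le_abs.2 (.inl (by linarith))
  have meridian : S.hol N.meridian = A (-1) hi lo * A 1 lo hi :=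
    N.hol_meridian_eq_along_mul_along S r rfl
  rw [circHol_comap_inclBottom_collar_zero, hf, ← hS, meridian, sideHol_collar, sideHol_collar]
  calc A 1 0 1 = A 1 0 hi * A 1 hi 1 := (S.along_mul _ _ _ _).symm
    _ = A 1 0 hi * (A (-1) hi lo * (A (-1) 0 lo)⁻¹ * A (-1) 0 1) := by
      rw [above, S.along_inv, S.along_mul, S.along_mul]
    _ = A 1 0 hi * (A (-1) hi lo * (A 1 0 hi * A 1 hi lo)⁻¹ * A (-1) 0 1) := by
      rw [← below, S.along_mul]
    _ = A 1 0 hi * (A (-1) hi lo * A 1 lo hi) * (A 1 0 hi)⁻¹ * A (-1) 0 1 := by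
      rw [mul_inv_rev, show (A 1 hi lo)⁻¹ = A 1 lo hi from S.along_inv _ _ _]
      group

theorem sideHol_one {y : F} (hy : y ∈ Set.range N.collar) :
    N.sideHol S 1 y = f (N.circHol (S.comap N.inclBottom) y) * N.sideHol S (-1) y := by
  obtain ⟨p, rfl⟩ := hy
  let w : Path (N.collar (0, 0)) (N.collar p) :=
    (PathConnectedSpace.somePath (0, 0) p).map N.collarMap.continuous
  have hw (t : I) : w t ∈ Set.range N.collar := Set.mem_range_self _
  have pos := N.sideHol_mul_hol S 1 w hw
  have neg := N.sideHol_mul_hol S (-1) w hw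
  have circ := N.map_circHol_mul_hol hf (R := S.comap N.inclBottom) w hw
  apply mul_left_cancel (a := (S.comap N.inclBottom).hol w)
  rw [← mul_assoc, ← circ, mul_assoc, ← neg, ← mul_assoc]
  exact pos.symm.trans (congrArg (· * _) (N.sideHol_one_collar_zero hf hS))

omit hf hS

/-- The closed annulus over which the solid torus lies. -/
def annulus : Set F := N.collar '' {p | |p.2| ≤ 1}

theorem isClosed_annulus [T2Space F] : IsClosed N.annulus := by
  have : N.annulus = N.collar '' (Set.Icc 0 1 ×ˢ Set.Icc (-1) 1) := by
    refine Set.Subset.antisymm ?_ (Set.image_mono fun p hp => abs_le.2 hp.2)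
    rintro _ ⟨p, hp, rfl⟩
    refine ⟨(Int.fract p.1, p.2), ⟨⟨Int.fract_nonneg _, (Int.fract_lt_one _).le⟩, abs_le.1 hp⟩, ?_⟩
    rw [← N.collar_add_int _ ⌊p.1⌋, Int.fract_add_floor]
  rw [this]
  exact ((isCompact_Icc.prod isCompact_Icc).image N.smooth.continuous).isClosed

theorem carrier_subset_annulus : C.carrier ⊆ N.annulus := by
  rintro _ ⟨s, rfl⟩
  exact ⟨(s, 0), by simp, N.core s⟩

theorem base_notMem_annulus : x ∉ N.annulus := fun ⟨p, hp, h⟩ => N.base_notMem p.1 p.2 hp h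

variable {N}

theorem mem_exterior_of_notMem_annulus {y : F} (hy : y ∉ N.annulus) (t : I) :
    (y, (t : ℝ)) ∈ N.exterior :=
  ⟨t.2, fun s z hz he => hy ⟨(s, -z.im), by
    simpa using (Complex.abs_im_le_norm z).trans hz.le, congrArg Prod.fst he⟩⟩

/-- The vertical path over a point off the annulus. -/
def verticalAt {y : F} (hy : y ∉ N.annulus) : Path (N.inclBottom y) (N.inclTop y) where
  toFun t := ⟨(y, t), mem_exterior_of_notMem_annulus hy t⟩
  continuous_toFun := by fun_prop
  source' := rfl
  target' := rfl

theorem hol_verticalAt_mul_hol (S : Transport N.exterior G) {a b : F} (w : Path a b)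
    (hw : ∀ t, w t ∉ N.annulus) (ha : a ∉ N.annulus) (hb : b ∉ N.annulus) :
    S.hol (verticalAt ha) * (S.comap N.inclTop).hol w =
      (S.comap N.inclBottom).hol w * S.hol (verticalAt hb) := by
  let k : C(I × I, N.exterior) :=
    ⟨fun q => ⟨(w q.1, q.2), mem_exterior_of_notMem_annulus (hw q.1) q.2⟩, by fun_prop⟩
  have at_source : S.hol (verticalAt ha) = S.along k (0, 0) (0, 1) :=
    S.hol_eq_along k ((Path.refl 0).prod (segPath 0 1)) fun t =>
      Subtype.ext (Prod.ext w.source.symm (congrArg Subtype.val (segPath_zero_one t).symm))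
  have at_target : S.hol (verticalAt hb) = S.along k (1, 0) (1, 1) :=
    S.hol_eq_along k ((Path.refl 1).prod (segPath 0 1)) fun t =>
      Subtype.ext (Prod.ext w.target.symm (congrArg Subtype.val (segPath_zero_one t).symm))
  have at_top : (S.comap N.inclTop).hol w = S.along k (0, 1) (1, 1) :=
    S.hol_eq_along k ((segPath 0 1).prod (Path.refl 1)) fun t =>
      Subtype.ext (Prod.ext (congrArg w (segPath_zero_one t).symm) rfl)
  have at_bottom : (S.comap N.inclBottom).hol w = S.along k (0, 0) (1, 0) :=
    S.hol_eq_along k ((segPath 0 1).prod (Path.refl 0)) fun t =>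
      Subtype.ext (Prod.ext (congrArg w (segPath_zero_one t).symm) rfl)
  rw [at_source, at_top, at_bottom, at_target, S.along_mul, S.along_mul]

theorem hol_verticalAt_eq_sideHol (S : Transport N.exterior G) {e : ℤˣ} {p : ℝ × ℝ}
    (hp : 1 ≤ (e : ℤ) * p.2) (h : N.collar p ∉ N.annulus) :
    S.hol (verticalAt h) = N.sideHol S e (N.collar p) := by
  rw [sideHol_collar]
  refine S.hol_eq_along _ ((Path.refl p).prod (segPath 0 1)) fun t =>
    Subtype.ext (Prod.ext (congrArg (fun u => N.collar (p.1, u)) ?_)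
      (congrArg Subtype.val (segPath_zero_one t).symm))
  exact (N.sideCoord_of_le ((N.halfWidth_le_one _).trans hp)).symm

variable (N) (S f)

open Classical in
/-- The change of frame from the bottom to the top of the cylinder given by `S`: off the annulus it
is the transport along the vertical paths. Over the collar, the vertical paths to the right of `C`
are continued past the solid torus on the right side, and the discrepancy to the left of `C` is
accounted for by `leftGauge`. -/
def verticalFrame (y : F) : G :=
  if hy : y ∈ N.annulus then N.leftGauge (S.comap N.inclBottom) f y * N.sideHol S (-1) y
  else S.hol (verticalAt hy)

variable {N S f}

theorem verticalFrame_of_notMem_annulus {y : F} (hy : y ∉ N.annulus) :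
    N.verticalFrame S f y = S.hol (verticalAt hy) :=
  dif_neg hy

include hf hS

theorem verticalFrame_of_mem_range_collar {y : F} (hy : y ∈ Set.range N.collar) :
    N.verticalFrame S f y = N.leftGauge (S.comap N.inclBottom) f y * N.sideHol S (-1) y := by
  by_cases h : y ∈ N.annulus
  · exact dif_pos h
  · obtain ⟨p, rfl⟩ := hy
    have hp : 1 < |p.2| := lt_of_not_ge fun hp => h ⟨p, hp, rfl⟩
    rw [verticalFrame_of_notMem_annulus h]
    rcases lt_abs.1 hp with hp | hp
    · rw [leftGauge_of_pos N (by rw [offset_collar]; linarith),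
        hol_verticalAt_eq_sideHol S (e := 1) (by simpa using hp.le),
        N.sideHol_one hf hS (Set.mem_range_self p)]
    · rw [leftGauge_of_nonpos N (by rw [offset_collar]; linarith), one_mul,
        hol_verticalAt_eq_sideHol S (e := -1) (by simpa using hp.le)]

namespace IsTwist

variable {T : Transport N.exterior G} [T2Space F]

theorem hol_comap_inclTop_eq_gauge (hT : N.IsTwist (S.comap N.inclBottom) f T) {a b : F}
    (p : Path a b) :
    (S.comap N.inclTop).hol p = ((T.comap N.inclTop).gauge (N.verticalFrame S f)).hol p := by
  refine Transport.hol_eq_of_forall_hol_eq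
    (U := fun near : Bool => bif near then Set.range N.collar else N.annulusᶜ)
    (Bool.forall_bool.2 ⟨N.isClosed_annulus.isOpen_compl, N.isOpenMap_collar.isOpen_range⟩)
    (fun y => Bool.exists_bool.2 ?_)
    (Bool.forall_bool.2 ⟨fun {a b} p hp => ?_, fun {a b} p hp => ?_⟩) p
  · exact or_iff_not_imp_left.2 fun hy => Set.image_subset_range _ _ (Set.not_notMem.1 hy)
  · have ha : a ∉ N.annulus := by simpa using hp 0
    have hb : b ∉ N.annulus := by simpa using hp 1
    have disjoint : Disjoint C.carrier (Set.range p) := Set.disjoint_right.2 <| by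
      rintro _ ⟨t, rfl⟩ ht
      exact hp t (N.carrier_subset_annulus ht)
    rw [Transport.hol_gauge, hT.hol_comap_inclTop_of_disjoint disjoint,
      verticalFrame_of_notMem_annulus ha, verticalFrame_of_notMem_annulus hb, mul_assoc,
      ← hol_verticalAt_mul_hol S p hp ha hb, inv_mul_cancel_left]
  · have ha : a ∈ Set.range N.collar := by simpa using hp 0
    have hb : b ∈ Set.range N.collar := by simpa using hp 1
    rw [Transport.hol_gauge, hT.hol_comap_inclTop_of_mem_range_collar p hp,
      verticalFrame_of_mem_range_collar hf hS ha, verticalFrame_of_mem_range_collar hf hS hb,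
      eq_inv_mul_of_mul_eq (N.sideHol_mul_hol S (-1) p hp)]
    group

theorem hol_connect_vertical (hT : N.IsTwist (S.comap N.inclBottom) f T) (l : Path x x) :
    S.hol (connect N.vertical (l.map N.inclTop.continuous)) = (T.comap N.inclTop).hol l := by
  have frame : N.verticalFrame S f x = S.hol N.vertical :=
    verticalFrame_of_notMem_annulus N.base_notMem_annulus
  have h := hT.hol_comap_inclTop_eq_gauge hf hS l
  rw [Transport.hol_gauge, frame] at h
  rw [S.hol_connect]
  change S.hol N.vertical * (S.comap N.inclTop).hol l * _ = _
  rw [h]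
  group

end IsTwist

end PertTube

/-! ### Perturbed representations -/

namespace PertTube

variable {F : Type*} [TopologicalSpace F] [ChartedSpace (EuclideanSpace ℝ (Fin 2)) F]
  {C : EmbeddedCircle F} {x : F} {N : PertTube C x} {k : ℕ} {φ : PertFun k}

variable (N) in
theorem joined_corner [PathConnectedSpace F] : Joined (N.inclBottom x) N.corner := by
  have bottom : Joined (N.inclBottom x) (N.inclBottom (N.collar (0, 0))) :=
    ⟨(PathConnectedSpace.somePath x _).map N.inclBottom.continuous⟩
  have side : Joined (N.sideMap 1 ((0, 0), 0)) (N.sideMap 1 ((0, 0), N.heightMap N.corner)) :=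
    ⟨(PathConnectedSpace.somePath _ _).map (N.sideMap 1).continuous⟩
  have corner : N.corner = N.sideMap 1 ((0, 0), N.heightMap N.corner) := by
    simpa using N.meridian_eq_sideMap (e := 1) (t := 0) (by simp)
  rw [sideMap_zero, ← corner] at side
  exact bottom.trans side

theorem isPerturbed_iff [PathConnectedSpace F] {ρ : Rep N.exterior (N.inclBottom x)}
    {S : Transport N.exterior SU2} (hS : ∀ p, S.hol p = ρ (loopClass p)) :
    N.IsPerturbed φ ρ ↔ S.hol N.meridian = pertMap φ (S.hol N.longitude) := by
  have perturbed_iff (δ : Path (N.inclBottom x) N.corner) :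
      ρ (loopClass (connect δ N.meridian)) = pertMap φ (ρ (loopClass (connect δ N.longitude))) ↔
        S.hol N.meridian = pertMap φ (S.hol N.longitude) := by
    rw [← hS, ← hS, S.hol_connect, S.hol_connect, pertMap_conj, mul_left_inj, mul_right_inj]
  exact ⟨fun h => (perturbed_iff _).1 (h N.joined_corner.some), fun h δ => (perturbed_iff δ).2 h⟩

namespace PertRep

variable {τ τ' : N.PertRep φ} {S : Transport N.exterior SU2}

theorem bottom_loopClass (hS : ∀ p, S.hol p = τ.1 (loopClass p)) (l : Path x x) :
    τ.bottom (loopClass l) = (S.comap N.inclBottom).hol l := by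
  change τ.1 (pi1Map N.inclBottom x (Path.refl _) (loopClass l)) = _
  rw [pi1Map_loopClass, ← hS, S.hol_connect, S.hol_refl, one_mul, inv_one, mul_one]
  rfl

theorem top_loopClass (hS : ∀ p, S.hol p = τ.1 (loopClass p)) (l : Path x x) :
    τ.top (loopClass l) = S.hol (connect N.vertical (l.map N.inclTop.continuous)) := by
  change τ.1 (pi1Map N.inclTop x N.vertical (loopClass l)) = _
  rw [pi1Map_loopClass, ← hS]

/-- After a change of frame that does not depend on the height, the two representations agree at
the bottom; then their tops are that of a common twist. -/
theorem exists_top_eq_conj [T2Space F] [PathConnectedSpace F] {g : SU2}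
    (h : ∀ a, τ'.bottom a = g * τ.bottom a * g⁻¹) :
    ∃ g' : SU2, ∀ a, τ'.top a = g' * τ.top a * g'⁻¹ := by
  obtain ⟨S, hS⟩ := Transport.exists_hol_eq τ.1
  obtain ⟨S', hS'⟩ := Transport.exists_hol_eq τ'.1
  obtain ⟨u, hu⟩ : ∃ u, S'.comap N.inclBottom = (S.comap N.inclBottom).gauge u :=
    Transport.exists_hol_eq_gauge (x := x) g fun p => by
      rw [← bottom_loopClass hS, ← bottom_loopClass hS', h]
  have meridian := (isPerturbed_iff hS).1 τ.2
  have meridian' := (isPerturbed_iff hS').1 τ'.2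
  have meridian_gauge : (S.gauge (u ∘ N.proj)).hol N.meridian =
      pertMap φ ((S.gauge (u ∘ N.proj)).hol N.longitude) := by
    have conj := pertMap_conj φ (u (N.proj N.corner))⁻¹ (S.hol N.longitude)
    rw [inv_inv] at conj
    rw [Transport.hol_gauge, Transport.hol_gauge, Function.comp_apply, conj, meridian]
  obtain ⟨T, hT⟩ := N.exists_isTwist (R := S'.comap N.inclBottom) (pertMap_conj φ)
  have hT_gauge : N.IsTwist ((S.comap N.inclBottom).gauge u) (pertMap φ) T := hu ▸ hT
  refine ⟨(u x)⁻¹, fun a => ?_⟩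
  obtain ⟨l, rfl⟩ := loopClass_surjective a
  rw [top_loopClass hS, top_loopClass hS', hT.hol_connect_vertical (pertMap_conj φ) meridian',
    ← IsTwist.hol_connect_vertical (pertMap_conj φ) meridian_gauge hT_gauge, Transport.hol_gauge,
    inv_inv]
  rfl

variable (τ) in
theorem phi_mk_bottom [T2Space F] [PathConnectedSpace F] :
    N.Phi φ (CharVar.mk τ.bottom) = CharVar.mk τ.top := by
  have factors : (N.restrictTop φ).FactorsThrough (N.restrictBottom φ) := fun c c' h => by
    induction c using Quotient.inductionOn
    induction c' using Quotient.inductionOn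
    obtain ⟨g, hg⟩ := Quotient.exact h
    exact Quotient.sound (exists_top_eq_conj hg)
  exact factors.extend_apply id (Quotient.mk _ τ)

end PertRep

end PertTube

theorem PertTube.IsTwist.exists_pertRep {F : Type*} [TopologicalSpace F] [PathConnectedSpace F]
    [ChartedSpace (EuclideanSpace ℝ (Fin 2)) F] {x : F} {C : EmbeddedCircle F} {N : PertTube C x}
    {k : ℕ} {φ : PertFun k} {ρ : Rep F x} {R : Transport F SU2}
    (hR : ∀ p, R.hol p = ρ (loopClass p)) {T : Transport N.exterior SU2}
    (hT : N.IsTwist R (pertMap φ) T) :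
    ∃ ρ' : N.PertRep φ, ρ'.bottom = ρ ∧
      ∀ p, ρ'.top (loopClass p) = (T.comap N.inclTop).hol p := by
  have hol_eq (p : Path (N.inclBottom x) _) := (T.toHom_loopClass p).symm
  let ρ' : N.PertRep φ :=
    ⟨T.toHom _, (isPerturbed_iff hol_eq).2 (hT.hol_meridian (pertMap_conj φ))⟩
  refine ⟨ρ', MonoidHom.ext fun a => ?_, fun p => ?_⟩
  · obtain ⟨p, rfl⟩ := loopClass_surjective a
    rw [PertRep.bottom_loopClass hol_eq, hT.hol_comap_inclBottom, hR]
  · rw [PertRep.top_loopClass hol_eq, T.hol_connect, hT.hol_vertical, one_mul, inv_one,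
      mul_one]
    rfl

end CylinderPert

end

open CylinderPert in
theorem proposition7p2_general {F : Type*} [TopologicalSpace F] [T2Space F] [ConnectedSpace F]
    [ChartedSpace (EuclideanSpace ℝ (Fin 2)) F] (x : F) (C : EmbeddedCircle F) (N : PertTube C x)
    {k : ℕ} (φ : PertFun k) (ρ : Rep F x) :
    ∃ ρ' : N.PertRep φ, ρ'.bottom = ρ ∧ N.Phi φ (CharVar.mk ρ) = CharVar.mk ρ'.top ∧
      ∀ {p : F} (γ : Path x p) (E : Path p p),
        (Disjoint C.carrier (Set.range E ∪ Set.range γ) →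
          ρ'.top (loopClass (connect γ E)) = ρ (loopClass (connect γ E))) ∧
        (∀ (t : unitInterval) (s : ℝ) (ε : ℤˣ) (h : MeetsOnce E C t s ε),
          Disjoint C.carrier (Set.range γ) →
          ∀ (α : ℝ) (Q : ℍ[ℝ]), IsUnitImag Q →
            (ρ (loopClass (longitudeLoop C γ E h.meets)) : ℍ[ℝ]) = NormedSpace.exp (α • Q) →
            (ρ'.top (loopClass (connect γ E)) : ℍ[ℝ]) =
              NormedSpace.exp ((((ε : ℤ) : ℝ) * φ α) • Q) * ρ (loopClass (connect γ E))) ∧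
        (∀ (t : unitInterval) (s : ℝ) (ε : ℤˣ) (h : MeetsOnce γ C t s ε),
          Disjoint C.carrier (Set.range E) →
          ∀ (α : ℝ) (Q : ℍ[ℝ]), IsUnitImag Q →
            (ρ (loopClass (longitudeArc C γ h.meets)) : ℍ[ℝ]) = NormedSpace.exp (α • Q) →
            (ρ'.top (loopClass (connect γ E)) : ℍ[ℝ]) =
              NormedSpace.exp ((((ε : ℤ) : ℝ) * φ α) • Q) * ρ (loopClass (connect γ E)) *
                NormedSpace.exp (-(((ε : ℤ) : ℝ) * φ α) • Q)) := by
  have : LocallyPathConnectedSpace F :=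
    ChartedSpace.locallyPathConnectedSpace (EuclideanSpace ℝ (Fin 2)) F
  have : PathConnectedSpace F := pathConnectedSpace_iff_connectedSpace.2 inferInstance
  obtain ⟨R, hR⟩ := Transport.exists_hol_eq ρ
  obtain ⟨T, hT⟩ := N.exists_isTwist (R := R) (pertMap_conj φ)
  obtain ⟨ρ', hbottom, htop⟩ := hT.exists_pertRep hR
  refine ⟨ρ', hbottom, hbottom ▸ ρ'.phi_mk_bottom, fun γ E => ⟨fun h => ?_,
    fun t s ε h hγ α Q hQ hα => ?_, fun t s ε h hE α Q hQ hα => ?_⟩⟩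
  · obtain ⟨hE, hγ⟩ := Set.disjoint_union_right.1 h
    rw [htop, ← hR, Transport.hol_connect, R.hol_connect, hT.hol_comap_inclTop_of_disjoint hE,
      hT.hol_comap_inclTop_of_disjoint hγ]
  · rw [htop, hT.hol_comap_inclTop_connect_of_meetsOnce_loop (pertMap_conj φ) h hγ, hR, hR,
      Submonoid.coe_mul, coe_pertMap_zpow φ _ hQ hα]
  · rw [htop, hT.hol_comap_inclTop_connect_of_meetsOnce_arc (pertMap_conj φ) h hE, hR, hR,
      Submonoid.coe_mul, Submonoid.coe_mul, coe_pertMap_zpow φ _ hQ hα,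
      coe_inv_pertMap_zpow φ _ hQ hα]

open CylinderPert in
theorem proposition7p2 {F : Type*} [TopologicalSpace F] [T2Space F] [CompactSpace F]
    [ConnectedSpace F] [ChartedSpace (EuclideanSpace ℝ (Fin 2)) F] [IsManifold (𝓡 2) ∞ F]
    (hF : IsOrientedAtlas F) (x : F) (C : EmbeddedCircle F) (N : PertTube C x)
    {k : ℕ} (φ : PertFun k) (ρ : Rep F x) :
    ∃ ρ' : N.PertRep φ, ρ'.bottom = ρ ∧ N.Phi φ (CharVar.mk ρ) = CharVar.mk ρ'.top ∧
      ∀ {p : F} (γ : Path x p) (E : Path p p),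
        -- `C` misses `E` and `γ`
        (Disjoint C.carrier (Set.range E ∪ Set.range γ) →
          ρ'.top (loopClass (connect γ E)) = ρ (loopClass (connect γ E))) ∧
        -- `C` meets `E` once with `E · C = ε` and misses `γ`
        (∀ (t : unitInterval) (s : ℝ) (ε : ℤˣ) (h : MeetsOnce E C t s ε),
          Disjoint C.carrier (Set.range γ) →
          ∀ (α : ℝ) (Q : ℍ[ℝ]), IsUnitImag Q →
            (ρ (loopClass (longitudeLoop C γ E h.meets)) : ℍ[ℝ]) = NormedSpace.exp (α • Q) →
            (ρ'.top (loopClass (connect γ E)) : ℍ[ℝ]) =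
              NormedSpace.exp ((((ε : ℤ) : ℝ) * φ α) • Q) * ρ (loopClass (connect γ E))) ∧
        -- `C` misses `E` and meets `γ` once with `γ · C = ε`
        (∀ (t : unitInterval) (s : ℝ) (ε : ℤˣ) (h : MeetsOnce γ C t s ε),
          Disjoint C.carrier (Set.range E) →
          ∀ (α : ℝ) (Q : ℍ[ℝ]), IsUnitImag Q →
            (ρ (loopClass (longitudeArc C γ h.meets)) : ℍ[ℝ]) = NormedSpace.exp (α • Q) →
            (ρ'.top (loopClass (connect γ E)) : ℍ[ℝ]) =
              NormedSpace.exp ((((ε : ℤ) : ℝ) * φ α) • Q) * ρ (loopClass (connect γ E)) *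
                NormedSpace.exp (-(((ε : ℤ) : ℝ) * φ α) • Q)) :=
  proposition7p2_general x C N φ ρ
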